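/- Let $k$ be a number field with ring of integers $\mathfrak o_k$, let $d_k=|d_{k/\mathbb Q}|$, let $r_1$ be the number of real places and $\mu(k)$ the group of roots of unity of $k$. Let $Z^1(X_k)=\bigoplus_{\mathfrak p}\mathbb Z\,\mathfrak p\oplus\bigoplus_{v\mid\infty}\mathbb R\,v$ be the group of Arakelov divisors, with Haar measure $dD$ the product of counting measure and Lebesgue measure. Let $CH^1(X_k)=Z^1(X_k)/\mathrm{div}(k^*)$, where $\mathrm{div}(f)=\sum_{\mathfrak p}\mathrm{ord}_{\mathfrak p}(f)\,\mathfrak p-\sum_v e_v\log|f|_v\,v$, $|f|_v=|\sigma_v(f)|$ for an embedding $\sigma_v$ in the class of $v$, and $e_v=1$ or $2$ according as $v$ is real or complex; let $d\mathcal D$ be the Haar measure on $CH^1(X_k)$ induced by $dD$ (the quotient by counting measure on $\mathrm{div}(k^*)$). For $D=\sum\nu_{\mathfrak p}\mathfrak p+\sum x_v v$ and $\mathcal D=[D]$ put $I(D)=\prod\mathfrak p^{-\nu_{\mathfrak p}}$ and $$k^0(\mathcal D)=\sum_{f\in I(D)}e^{-\pi\|f\|_D^2},\qquad \|f\|_D^2=\sum_{v\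 \mathrm{real}}|f|_v^2e^{-2x_v}+2\sum_{v\ \mathrm{complex}}|f|_v^2e^{-x_v},\qquad k^1(\mathcal D)=k^0([\kappa]-\mathcal D),$$ where $\kappa$ has zero infinite components and $I(\kappa)$ is the inverse different of $k/\mathbb Q$. The integral $\zeta^{GS}_{X_k}(s,t)=\int_{CH^1(X_k)}k^0(\mathcal D)^sk^1(\mathcal D)^t\,d\mathcal D$ converges absolutely for $\mathrm{Re}\,s<0$, $\mathrm{Re}\,t<0$. With $\zeta_{X_k}(s,w)=\zeta^{GS}_{X_k}(s,w-s)$, there is exactly one holomorphic function $L(H^1(X_k),s,w)$ of $(s,w)\in\mathbb C^2$ with $$L(H^1(X_k),s,w)=\frac1{4\pi^2}\,\frac{s(s-w)}{w}\,\frac{2^{r_1/2}}{|\mu(k)|}\,d_k^{-s/2}\,\zeta_{X_k}(s,w)\qquad\text{for } \mathrm{Re}\,w<\mathrm{Re}\,s<0.$$ For every fixed $w\in\mathbb C$ the entire function $s\mapsto L(H^1(X_k),s,w)$ has order at most one, i.e. for every $\varepsilon>0$ it is $O(\exp(|s|^{1+\varepsilon}))$ as $|s|\to\infty$, where the implied constant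 may depend on $k$, $w$ and $\varepsilon$. -/

import Mathlib

open scoped nonZeroDivisors

noncomputable section

namespace ArakelovZeta

open NumberField IsDedekindDomain MeasureTheory

section Divisors

variable (k : Type*) [Field k] [NumberField k]

/-- Finite parts of Arakelov divisors: the direct sum of copies of `ℤ` over the nonzero primes. -/
abbrev FinDivisor : Type _ := HeightOneSpectrum (𝓞 k) →₀ ℤ

/-- The group `Z¹(X_k) = ⨁_𝔭 ℤ·𝔭 ⊕ ⨁_{v ∣ ∞} ℝ·v` of Arakelov divisors: the first component
holds the multiplicities `ν_𝔭`, the second one the real coefficients `x_v`. -/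
abbrev ArakelovDivisor : Type _ := FinDivisor k × (InfinitePlace k → ℝ)

/-- `⨁_𝔭 ℤ·𝔭` is a discrete (countable) group, so all its subsets are measurable. -/
instance instMeasurableSpaceFinDivisor : MeasurableSpace (FinDivisor k) := ⊤

/-- The Haar measure `dD` on `Z¹(X_k)`: the product of the counting measure on the finite parts and
of Lebesgue measure on the infinite parts. -/
def divisorMeasure : Measure (ArakelovDivisor k) :=
  (Measure.count : Measure (FinDivisor k)).prod (volume : Measure (InfinitePlace k → ℝ))

variable {k}

/-- The finite divisor `∑_𝔭 ord_𝔭(I)·𝔭` of a fractional ideal. -/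
def ordDivisor (I : FractionalIdeal (𝓞 k)⁰ k) : FinDivisor k :=
  Finsupp.ofSupportFinite (fun p => FractionalIdeal.count k p I)
    (Filter.eventually_cofinite.mp (FractionalIdeal.finite_factors I))

@[simp] theorem ordDivisor_apply (I : FractionalIdeal (𝓞 k)⁰ k) (p : HeightOneSpectrum (𝓞 k)) :
    ordDivisor I p = FractionalIdeal.count k p I := rfl

variable (k) in
/-- The homomorphism `div : k^* → Z¹(X_k)`,
`div f = ∑_𝔭 ord_𝔭(f)·𝔭 - ∑_v e_v log|f|_v·v`, with `e_v = 1` for `v` real and `e_v = 2` for `v`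
complex (this is `InfinitePlace.mult`) and with `|f|_v = |σ_v(f)|`. -/
def principal : Additive kˣ →+ ArakelovDivisor k where
  toFun f := (ordDivisor (FractionalIdeal.spanSingleton (𝓞 k)⁰ ((Additive.toMul f : kˣ) : k)),
    fun v => -((v.mult : ℝ) * Real.log (v ((Additive.toMul f : kˣ) : k))))
  map_zero' := by
    refine Prod.ext ?_ ?_
    · ext p
      simp [FractionalIdeal.count_one]
    · ext v
      simp
  map_add' f g := by
    refine Prod.ext ?_ ?_
    · ext p
      have hf : FractionalIdeal.spanSingleton (𝓞 k)⁰ ((Additive.toMul f : kˣ) : k) ≠ 0 :=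
        FractionalIdeal.spanSingleton_ne_zero_iff.mpr (Units.ne_zero _)
      have hg : FractionalIdeal.spanSingleton (𝓞 k)⁰ ((Additive.toMul g : kˣ) : k) ≠ 0 :=
        FractionalIdeal.spanSingleton_ne_zero_iff.mpr (Units.ne_zero _)
      simp [← FractionalIdeal.spanSingleton_mul_spanSingleton,
        FractionalIdeal.count_mul k p hf hg]
    · ext v
      have hf : v ((Additive.toMul f : kˣ) : k) ≠ 0 := by simp
      have hg : v ((Additive.toMul g : kˣ) : k) ≠ 0 := by simp
      simp [Real.log_mul hf hg]
      ring

/-- The fractional ideal `I(D) = ∏_𝔭 𝔭^{-ν_𝔭}`. -/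
def divisorIdeal (D : ArakelovDivisor k) : FractionalIdeal (𝓞 k)⁰ k :=
  D.1.prod fun p n => (p.asIdeal : FractionalIdeal (𝓞 k)⁰ k) ^ (-n)

open Classical in
/-- `‖f‖_D² = ∑_{v real} |f|_v² e^{-2 x_v} + 2 ∑_{v complex} |f|_v² e^{-x_v}` for `f ∈ k`. -/
def divisorNormSq (D : ArakelovDivisor k) (f : k) : ℝ :=
  ∑ v : InfinitePlace k,
    if v.IsReal then v f ^ 2 * Real.exp (-2 * D.2 v) else 2 * (v f ^ 2 * Real.exp (-D.2 v))

/-- The theta series `k⁰(D) = ∑_{f ∈ I(D)} exp(-π ‖f‖_D²)`. -/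
def theta (D : ArakelovDivisor k) : ℝ :=
  ∑' f : divisorIdeal D, Real.exp (-(Real.pi * divisorNormSq D (f : k)))

theorem divisorIdeal_ne_zero (D : ArakelovDivisor k) : divisorIdeal D ≠ 0 := by
  rw [divisorIdeal, Finsupp.prod, Finset.prod_ne_zero_iff]
  exact fun p _ => zpow_ne_zero _ (FractionalIdeal.coeIdeal_ne_zero.mpr p.ne_bot)

theorem divisorIdeal_add (D E : ArakelovDivisor k) :
    divisorIdeal (D + E) = divisorIdeal D * divisorIdeal E := by
  classical
  refine Finsupp.prod_add_index' (by simp) fun p m n => ?_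
  rw [neg_add, zpow_add₀ (FractionalIdeal.coeIdeal_ne_zero.mpr p.ne_bot)]

theorem divisorIdeal_principal (f : Additive kˣ) :
    divisorIdeal (principal k f) =
      (FractionalIdeal.spanSingleton (𝓞 k)⁰ ((Additive.toMul f : kˣ) : k))⁻¹ := by
  have hf : FractionalIdeal.spanSingleton (𝓞 k)⁰ ((Additive.toMul f : kˣ) : k) ≠ 0 :=
    FractionalIdeal.spanSingleton_ne_zero_iff.mpr (Units.ne_zero _)
  rw [← FractionalIdeal.finprod_heightOneSpectrum_factorization' k hf]
  rw [finprod_eq_prod_of_mulSupport_subset (s := (principal k f).1.support)]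
  · simp [divisorIdeal, Finsupp.prod, principal]
  · intro p hp
    simp only [Function.mem_mulSupport] at hp
    simp only [Finset.mem_coe, Finsupp.mem_support_iff]
    intro h
    apply hp
    have h' : FractionalIdeal.count k p
        (FractionalIdeal.spanSingleton (𝓞 k)⁰ ((Additive.toMul f : kˣ) : k)) = 0 := h
    rw [h', zpow_zero]

theorem divisorNormSq_add_principal (D : ArakelovDivisor k) (f : Additive kˣ) (g : k) :
    divisorNormSq (D + principal k f) g =
      divisorNormSq D (((Additive.toMul f : kˣ) : k) * g) := by
  refine Finset.sum_congr rfl fun v _ => ?_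
  have hf : 0 < v ((Additive.toMul f : kˣ) : k) := by simp [InfinitePlace.pos_iff]
  split_ifs with hv
  · have e : -2 * (D + principal k f).2 v
        = -2 * D.2 v + (Real.log (v ((Additive.toMul f : kˣ) : k)) +
          Real.log (v ((Additive.toMul f : kˣ) : k))) := by
      simp [principal, InfinitePlace.mult, hv]
      ring
    rw [e, Real.exp_add, Real.exp_add, Real.exp_log hf, map_mul]
    ring
  · have e : -(D + principal k f).2 v
        = -D.2 v + (Real.log (v ((Additive.toMul f : kˣ) : k)) +
          Real.log (v ((Additive.toMul f : kˣ) : k))) := by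
      simp [principal, InfinitePlace.mult, hv]
      ring
    rw [e, Real.exp_add, Real.exp_add, Real.exp_log hf, map_mul]
    ring

/-- The theta series depends only on the class of the divisor. -/
theorem theta_add_principal (D : ArakelovDivisor k) (f : Additive kˣ) :
    theta (D + principal k f) = theta D := by
  have hf : ((Additive.toMul f : kˣ) : k) ≠ 0 := by simp
  have hI : divisorIdeal D = FractionalIdeal.spanSingleton (𝓞 k)⁰ ((Additive.toMul f : kˣ) : k) *
      divisorIdeal (D + principal k f) := by
    rw [divisorIdeal_add, divisorIdeal_principal, mul_left_comm, mul_inv_cancel₀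
      (FractionalIdeal.spanSingleton_ne_zero_iff.mpr hf),
      mul_one]
  have key : ∀ g : k, ((Additive.toMul f : kˣ) : k) * g ∈ divisorIdeal D ↔
      g ∈ divisorIdeal (D + principal k f) := by
    intro g
    rw [hI, FractionalIdeal.mem_singleton_mul]
    exact ⟨fun ⟨y, hy, h⟩ => mul_left_cancel₀ hf h ▸ hy, fun h => ⟨g, h, rfl⟩⟩
  let e : divisorIdeal (D + principal k f) ≃ divisorIdeal D :=
    (Equiv.mulLeft₀ _ hf).subtypeEquiv fun g => (key g).symm
  unfold theta
  refine Eq.trans (tsum_congr fun g => ?_)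
    (e.tsum_eq fun g => Real.exp (-(Real.pi * divisorNormSq D (g : k))))
  rw [divisorNormSq_add_principal]
  rfl

end Divisors

section ChowGroup

variable (k : Type*) [Field k] [NumberField k]

/-- The Arakelov Chow group `CH¹(X_k)`, the cokernel of `div`. It carries the quotient σ-algebra. -/
abbrev ChowGroup : Type _ := ArakelovDivisor k ⧸ (principal k).range

/-- The class `[D]` of an Arakelov divisor. -/
abbrev divisorClass : ArakelovDivisor k →+ ChowGroup k := QuotientAddGroup.mk' (principal k).range

/-- The Haar measure `d𝒟` on `CH¹(X_k)` induced by `dD`: the quotient of `dD` by the counting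
measure of the discrete subgroup `div(k^*)`. It is the least measure on `CH¹(X_k)` that dominates the
push-forward of `dD` restricted to `B`, for every measurable set `B` of divisors on which the class
map is injective. It equals the push-forward of `dD` restricted to `F`, for any measurable set `F`
of representatives of all the classes (`chowMeasure_eq_map`). -/
def chowMeasure : Measure (ChowGroup k) :=
  ⨆ (B : Set (ArakelovDivisor k)) (_ : MeasurableSet B ∧ Set.InjOn (divisorClass k) B),
    ((divisorMeasure k).restrict B).map (divisorClass k)

variable {k}

instance instCountableFinDivisor : Countable (FinDivisor k) := by
  have h1 : Countable (𝓞 k) := (Module.finBasis ℤ (𝓞 k)).equivFun.toEquiv.injective.countable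
  have h2 : Countable (Ideal (𝓞 k)) := by
    refine Function.Surjective.countable
      (f := fun s : Finset (𝓞 k) => Ideal.span (s : Set (𝓞 k))) fun I => ?_
    exact (IsNoetherian.noetherian I)
  have h3 : Countable (HeightOneSpectrum (𝓞 k)) :=
    Function.Injective.countable (f := HeightOneSpectrum.asIdeal)
      fun _ _ h => HeightOneSpectrum.ext h
  infer_instance

/-- `d𝒟` can be computed on any measurable set of representatives. -/
theorem chowMeasure_eq_map {F : Set (ArakelovDivisor k)} (hF : MeasurableSet F)
    (hb : Set.BijOn (divisorClass k) F Set.univ) :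
    chowMeasure k = ((divisorMeasure k).restrict F).map (divisorClass k) := by
  have hπ : Measurable (divisorClass k) := measurable_quotient_mk''
  have hcl : ∀ (g : (principal k).range) (D : ArakelovDivisor k),
      divisorClass k ((g : ArakelovDivisor k) + D) = divisorClass k D := by
    intro g D
    have h : divisorClass k (g : ArakelovDivisor k) = 0 := (QuotientAddGroup.eq_zero_iff _).mpr g.2
    rw [map_add, h, zero_add]
  have hdisc : DiscreteMeasurableSpace (FinDivisor k) := ⟨fun _ => trivial⟩
  have hcount : Countable (principal k).range := by
    have h1 : Countable (𝓞 k) := (Module.finBasis ℤ (𝓞 k)).equivFun.toEquiv.injective.countable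
    have h2 : Countable k := by
      refine Function.Surjective.countable
        (f := fun x : 𝓞 k × 𝓞 k => (x.1 : k) / (x.2 : k)) fun z => ?_
      obtain ⟨a, b, -, h⟩ := IsFractionRing.div_surjective (A := 𝓞 k) z
      exact ⟨(a, b), h⟩
    have h3 : Countable kˣ := Units.val_injective.countable
    have h4 : Countable (Additive kˣ) := h3
    exact (principal k).rangeRestrict_surjective.countable
  have hadd : ∀ g : ArakelovDivisor k,
      MeasurePreserving (fun D => g + D) (divisorMeasure k) (divisorMeasure k) := by
    intro g
    have hm : MeasurableAdd (FinDivisor k) :=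
      { measurable_const_add := fun _ => measurable_of_countable _
        measurable_add_const := fun _ => measurable_of_countable _ }
    have h1 : MeasurePreserving (fun D : FinDivisor k => g.1 + D) Measure.count Measure.count :=
      measurePreserving_add_left Measure.count g.1
    exact h1.prod (measurePreserving_add_left volume g.2)
  have hmeas : MeasurableConstVAdd (principal k).range (ArakelovDivisor k) :=
    ⟨fun g => (hadd g).measurable⟩
  have hinv : VAddInvariantMeasure (principal k).range (ArakelovDivisor k) (divisorMeasure k) :=
    ⟨fun g s hs => (hadd g).measure_preimage hs.nullMeasurableSet⟩
  have hfd : IsAddFundamentalDomain (principal k).range F (divisorMeasure k) := by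
    refine IsAddFundamentalDomain.mk' hF.nullMeasurableSet fun D => ?_
    obtain ⟨E, hE, hED⟩ := hb.surjOn (Set.mem_univ (divisorClass k D))
    have hr : E - D ∈ (principal k).range := by
      have := QuotientAddGroup.eq.mp hED.symm
      rwa [neg_add_eq_sub] at this
    refine ⟨⟨E - D, hr⟩, by simpa [AddSubgroup.vadd_def] using hE, fun g hg => ?_⟩
    have : (g : ArakelovDivisor k) + D = E := by
      refine hb.injOn hg hE ?_
      rw [hED]
      exact hcl g D
    ext1
    simp [← this]
  apply le_antisymm
  · refine iSup₂_le fun B hB => Measure.le_iff.mpr fun A hA => ?_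
    rw [Measure.map_apply hπ hA, Measure.map_apply hπ hA,
      Measure.restrict_apply (hπ hA), Measure.restrict_apply (hπ hA),
      hfd.measure_eq_tsum, ← measure_iUnion]
    · refine measure_mono (Set.iUnion_subset fun g => ?_)
      rintro x ⟨⟨y, ⟨hyA, -⟩, rfl⟩, hxF⟩
      refine ⟨?_, hxF⟩
      change divisorClass k ((g : ArakelovDivisor k) + y) ∈ A
      rw [hcl]
      exact hyA
    · intro g g' hgg'
      refine Set.disjoint_left.mpr ?_
      rintro _ ⟨⟨y, ⟨-, hy⟩, rfl⟩, -⟩ ⟨⟨y', ⟨-, hy'⟩, hyy⟩, -⟩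
      apply hgg'
      have hyy' : (g' : ArakelovDivisor k) + y' = (g : ArakelovDivisor k) + y := hyy
      have e : y' = y := by
        refine hB.2 hy' hy ?_
        rw [← hcl g' y', hyy', hcl]
      ext1
      rw [e] at hyy'
      exact (add_right_cancel hyy').symm
    · exact fun g => (((hπ hA).inter hB.1).const_vadd g).inter hF
  · exact le_iSup₂_of_le F ⟨hF, hb.injOn⟩ le_rfl

/-- The function `k⁰` on `CH¹(X_k)`. -/
def k0 : ChowGroup k → ℝ :=
  Quotient.lift theta fun D E h => by
    obtain ⟨f, hf⟩ := (QuotientAddGroup.leftRel_apply.mp h : -D + E ∈ (principal k).range)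
    rw [← theta_add_principal D f, hf, add_neg_cancel_left]

variable (k) in
/-- The canonical divisor `κ`: zero at infinity, with `I(κ) = 𝔡⁻¹` for the different `𝔡` of `k/ℚ`,
that is, `ν_𝔭 = ord_𝔭(𝔡)`. -/
def canonicalDivisor : ArakelovDivisor k :=
  (ordDivisor ((differentIdeal ℤ (𝓞 k) : Ideal (𝓞 k)) : FractionalIdeal (𝓞 k)⁰ k), 0)

/-- `k¹(𝒟) = k⁰([κ] - 𝒟)`. -/
def k1 (C : ChowGroup k) : ℝ := k0 (divisorClass k (canonicalDivisor k) - C)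

end ChowGroup

section Zeta

variable (k : Type*) [Field k] [NumberField k]

/-- The integrand `k⁰(𝒟)^s k¹(𝒟)^t`. -/
def zetaIntegrand (s t : ℂ) (C : ChowGroup k) : ℂ := (k0 C : ℂ) ^ s * (k1 C : ℂ) ^ t

/-- The two-variable zeta function of van der Geer and Schoof
`ζ^GS(s,t) = ∫_{CH¹(X_k)} k⁰(𝒟)^s k¹(𝒟)^t d𝒟`, to be used for `Re s < 0`, `Re t < 0` only. -/
def zetaGS (s t : ℂ) : ℂ := ∫ C, zetaIntegrand k s t C ∂(chowMeasure k)

/-- `ζ_{X_k}(s,w) = ζ^GS(s, w - s)`, to be used for `Re w < Re s < 0` only. -/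
def zetaX (s w : ℂ) : ℂ := zetaGS k s (w - s)

/-- The normalized function `ζ(X_k,s,w) = w⁻¹ (2^{r₁/2} / |μ(k)|) d_k^{-s/2} ζ_{X_k}(s,w)`, to be
used for `Re w < Re s < 0` only. Here `d_k = |disc k|`, `r₁` is the number of real places, and
`μ(k)` is the group of roots of unity in `k`. -/
def zetaNormalized (s w : ℂ) : ℂ :=
  w⁻¹ * ((2 : ℂ) ^ ((InfinitePlace.nrRealPlaces k : ℂ) / 2) / (Units.torsionOrder k : ℂ)) *
    (((discr k).natAbs : ℂ) ^ (-s / 2)) * zetaX k s w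

/-- `L` is the two-variable function `(s, w) ↦ L(H¹(X_k), s, w)`: the holomorphic continuation to
`ℂ²` of `(s / 2π) ((s - w) / 2π) ζ(X_k,s,w)` from the region `Re w < Re s < 0`. -/
def IsTwoVariableL (L : ℂ → ℂ → ℂ) : Prop :=
  Differentiable ℂ (fun z : ℂ × ℂ => L z.1 z.2) ∧
    ∀ s w : ℂ, w.re < s.re → s.re < 0 →
      L s w = (s / (2 * Real.pi)) * ((s - w) / (2 * Real.pi)) * zetaNormalized k s w

end Zeta

/-- The order of growth of an entire function `f`: the infimum of all `a ≥ 0` such that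
`f(s) = O(exp(|s|^a))` as `|s| → ∞`. -/
def growthOrder (f : ℂ → ℂ) : ENNReal :=
  ⨅ (a : NNReal) (_ : f =O[Bornology.cobounded ℂ] fun s => Real.exp (‖s‖ ^ (a : ℝ))), (a : ENNReal)

end ArakelovZeta

end

noncomputable section

namespace ArakelovZeta

open MeasureTheory Set Filter Topology

/-! ### The entire function `(exp z - 1) / z` and the integrals built from it -/

/-! Put `y = deg - (log d_k) / 2` on the Arakelov class group. Riemann–Roch
(`theta_eq_theta_canonicalDivisor_sub`) says `k0 = k1 * exp y`, and the involution `𝒟 ↦ [κ] - 𝒟`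
exchanges `k0` and `k1` and negates `y`. Two further arithmetic facts enter. The distribution of `y`
is a constant `V` times Lebesgue measure (`exists_map_chowDegree_eq_smul`), by finiteness of the
class group and Dirichlet's unit theorem. And `k0 - 1` is at most `C exp (-c exp (κ |y|))` for `y ≤
0` (`exists_k0_le`), since every nonzero term of the theta series is tiny there.

For `y ≤ 0` one has `k0^s k1^(w-s) = exp (w log k0) exp ((s-w) y)`, and for `y > 0` it is `exp (w
log k1) exp (s y)`. Replacing the first factors by `1` gives `V (1/(s-w) - 1/s) = V w / (s (s-w))`.
What is left is `w` times `∫ l ψ(w l) exp (a y)`, with `ψ z = (exp z - 1) / z` and `l` a doubly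
exponentially small logarithm; this is entire in `(a, w)`. Multiplication by `s (s-w) / w` therefore
removes every singularity and gives the continuation `V + s (s-w) (J₁ (s-w, w) + J₂ (s, w))`, up to
a constant and the factor `d_k^(-s/2)`.

For the order, `|a| |y| ≤ |a|^(1+ε) + |y|^(1+1/ε)`, and the double exponential decay absorbs `exp
(|y|^p)` for every `p`; hence each `J` is `O (exp (|a|^(1+ε)))`. Uniqueness is the identity theorem
on complex lines.

Riemann–Roch is Poisson summation for the lattice `I(D)`: its dual under the trace form is `I(κ -
D)`, and the dual of the Gaussian with parameters `x` is the one with parameters `-x`. -/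

/-- The entire function `(exp z - 1) / z`. -/
def expQuot : ℂ → ℂ := dslope Complex.exp 0

theorem differentiable_expQuot : Differentiable ℂ expQuot := by
  rw [← differentiableOn_univ]
  exact (Complex.differentiableOn_dslope univ_mem).mpr Complex.differentiable_exp.differentiableOn

theorem mul_expQuot (z : ℂ) : z * expQuot z = Complex.exp z - 1 := by
  simpa [expQuot] using sub_smul_dslope Complex.exp 0 z

section Transform

variable {X : Type*} [MeasurableSpace X] (μ : Measure X) (l τ : X → ℝ)

/-- The transform `∫ l ψ(w l) exp(a τ)`, where `ψ z = (exp z - 1) / z`. -/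
def expTransform (a w : ℂ) : ℂ :=
  ∫ x, (l x : ℂ) * expQuot (w * l x) * Complex.exp (a * τ x) ∂μ

variable {μ l τ}

/-- By `R t ≤ R² + t²`, the single weight `exp (τ²)` controls all exponential weights. -/
theorem integrable_mul_exp_mul_abs (hl : Measurable l) (hτ : Measurable τ) (h0 : ∀ x, 0 ≤ l x)
    (hint : Integrable (fun x => l x * Real.exp (|τ x| ^ (2 : ℝ))) μ) (R : ℝ) :
    Integrable (fun x => l x * Real.exp (R * |τ x|)) μ := by
  refine (hint.const_mul (Real.exp (R ^ 2))).mono' (by fun_prop) (ae_of_all _ fun x => ?_)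
  rw [Real.norm_of_nonneg (mul_nonneg (h0 x) (Real.exp_pos _).le), mul_left_comm, ← Real.exp_add]
  refine mul_le_mul_of_nonneg_left (Real.exp_le_exp.mpr ?_) (h0 x)
  rw [Real.rpow_two]
  nlinarith [sq_nonneg (R - |τ x|), sq_nonneg R, sq_nonneg |τ x|]

theorem exists_bound_closedBall {f : ℂ → ℂ} (hf : Continuous f) (R : ℝ) :
    ∃ M, 0 ≤ M ∧ ∀ z, ‖z‖ ≤ R → ‖f z‖ ≤ M := by
  obtain ⟨M, hM⟩ := (isCompact_closedBall (0 : ℂ) R).exists_bound_of_continuousOn hf.continuousOn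
  refine ⟨max M 0, le_max_right _ _, fun z hz => (hM z ?_).trans (le_max_left _ _)⟩
  simpa using hz

theorem norm_exp_mul_le (a : ℂ) (t : ℝ) : ‖Complex.exp (a * t)‖ ≤ Real.exp (‖a‖ * |t|) := by
  refine (Complex.norm_exp_le_exp_norm _).trans (Real.exp_le_exp.mpr ?_)
  simp

/-- Differentiation under the integral in both variables at once. Since `0 ≤ l ≤ B`, the arguments
`w l` stay in a fixed disc while `(a, w)` runs over a unit ball, so `ψ` and `ψ'` are bounded there.
-/
theorem differentiable_expTransform (hl : Measurable l) (hτ : Measurable τ) (h0 : ∀ x, 0 ≤ l x)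
    {B : ℝ} (hB : ∀ x, l x ≤ B)
    (hint : Integrable (fun x => l x * Real.exp (|τ x| ^ (2 : ℝ))) μ) :
    Differentiable ℂ (fun z : ℂ × ℂ => expTransform μ l τ z.1 z.2) := by
  have hψ := differentiable_expQuot
  have hψc := hψ.continuous
  have hψ' : Continuous (deriv expQuot) := (hψ.contDiff (n := 1)).continuous_deriv le_rfl
  intro z₀
  set R : ℝ := ‖z₀‖ + 1 with hR
  obtain ⟨M₁, hM₁0, hM₁⟩ := exists_bound_closedBall hψc (R * B)
  obtain ⟨M₂, hM₂0, hM₂⟩ := exists_bound_closedBall hψ' (R * B)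
  let F' : ℂ × ℂ → X → ℂ × ℂ →L[ℂ] ℂ := fun z x =>
    ((l x : ℂ) * expQuot (z.2 * l x) * (τ x * Complex.exp (z.1 * τ x))) •
        ContinuousLinearMap.fst ℂ ℂ ℂ +
      ((l x : ℂ) * (l x * deriv expQuot (z.2 * l x)) * Complex.exp (z.1 * τ x)) •
        ContinuousLinearMap.snd ℂ ℂ ℂ
  have hmeas : ∀ z : ℂ × ℂ, Measurable
      (fun x => (l x : ℂ) * expQuot (z.2 * l x) * Complex.exp (z.1 * τ x)) := fun z =>
    ((by fun_prop : Measurable fun x => (l x : ℂ)).mul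
      (hψc.measurable.comp (by fun_prop))).mul (by fun_prop)
  have hbd : ∀ x, ∀ z ∈ Metric.ball z₀ 1, ‖z.1‖ ≤ R ∧ ‖z.2 * l x‖ ≤ R * B := by
    intro x z hz
    have h1 : ‖z‖ ≤ R := by
      have := norm_sub_norm_le z z₀
      rw [Metric.mem_ball, dist_eq_norm] at hz
      linarith
    refine ⟨(norm_fst_le z).trans h1, ?_⟩
    rw [norm_mul, Complex.norm_real, Real.norm_of_nonneg (h0 x)]
    exact mul_le_mul ((norm_snd_le z).trans h1) (hB x) (h0 x) (by positivity)
  have hexp : ∀ x, ∀ a : ℂ, ‖a‖ ≤ R → ‖Complex.exp (a * τ x)‖ ≤ Real.exp (R * |τ x|) := by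
    intro x a ha
    exact (norm_exp_mul_le a _).trans (Real.exp_le_exp.mpr (by gcongr))
  refine HasFDerivAt.differentiableAt (f' := ∫ x, F' z₀ x ∂μ) ?_
  refine hasFDerivAt_integral_of_dominated_of_fderiv_le
    -- The extra `1` in the exponent absorbs the factor `τ x` that comes from differentiating in
    -- `a`, by `|τ| ≤ exp |τ|`.
    (bound := fun x => (M₁ + B * M₂) * (l x * Real.exp ((R + 1) * |τ x|)))
    (Metric.ball_mem_nhds z₀ one_pos) (Eventually.of_forall fun z => (hmeas z).aestronglyMeasurable)
    ?_ ?_ (ae_of_all _ fun x z hz => ?_)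
    ((integrable_mul_exp_mul_abs hl hτ h0 hint (R + 1)).const_mul _) (ae_of_all _ fun x z _ => ?_)
  · refine ((integrable_mul_exp_mul_abs hl hτ h0 hint R).const_mul M₁).mono'
      (hmeas z₀).aestronglyMeasurable (ae_of_all _ fun x => ?_)
    obtain ⟨h1, h2⟩ := hbd x z₀ (Metric.mem_ball_self one_pos)
    rw [norm_mul, norm_mul, Complex.norm_real, Real.norm_of_nonneg (h0 x), mul_left_comm,
      ← mul_assoc]
    have := hM₁ _ h2
    have := hexp x _ h1
    have := h0 x
    gcongr
  · have h1 : Measurable fun x => (l x : ℂ) * expQuot (z₀.2 * l x) *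
        (τ x * Complex.exp (z₀.1 * τ x)) :=
      ((by fun_prop : Measurable fun x => (l x : ℂ)).mul
        (hψc.measurable.comp (by fun_prop))).mul (by fun_prop)
    have h2 : Measurable fun x => (l x : ℂ) * (l x * deriv expQuot (z₀.2 * l x)) *
        Complex.exp (z₀.1 * τ x) :=
      ((by fun_prop : Measurable fun x => (l x : ℂ)).mul
        ((by fun_prop : Measurable fun x => (l x : ℂ)).mul
          (hψ'.measurable.comp (by fun_prop)))).mul (by fun_prop)
    exact (h1.aestronglyMeasurable.smul_const _).add (h2.aestronglyMeasurable.smul_const _)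
  · obtain ⟨h1, h2⟩ := hbd x z hz
    have e1 := hM₁ _ h2
    have e2 := hM₂ _ h2
    have e3 := hexp x _ h1
    have e0 := h0 x
    have eB := hB x
    have eB0 : 0 ≤ B := e0.trans eB
    have e4 : |τ x| * Real.exp (R * |τ x|) ≤ Real.exp ((R + 1) * |τ x|) := by
      rw [add_mul R 1, Real.exp_add, one_mul, mul_comm |τ x|]
      exact mul_le_mul_of_nonneg_left (by linarith [Real.add_one_le_exp |τ x|]) (Real.exp_pos _).le
    have e5 : Real.exp (R * |τ x|) ≤ Real.exp ((R + 1) * |τ x|) := by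
      gcongr; linarith
    refine (norm_add_le _ _).trans ?_
    rw [norm_smul, norm_smul, add_mul]
    have f1 : ‖ContinuousLinearMap.fst ℂ ℂ ℂ‖ ≤ 1 := ContinuousLinearMap.norm_fst_le ..
    have f2 : ‖ContinuousLinearMap.snd ℂ ℂ ℂ‖ ≤ 1 := ContinuousLinearMap.norm_snd_le ..
    refine add_le_add ((mul_le_of_le_one_right (norm_nonneg _) f1).trans ?_)
      ((mul_le_of_le_one_right (norm_nonneg _) f2).trans ?_)
    · rw [norm_mul, norm_mul, norm_mul, Complex.norm_real, Complex.norm_real,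
        Real.norm_of_nonneg e0, Real.norm_eq_abs]
      calc l x * ‖expQuot (z.2 * l x)‖ * (|τ x| * ‖Complex.exp (z.1 * τ x)‖)
          ≤ l x * M₁ * (|τ x| * Real.exp (R * |τ x|)) := by gcongr
        _ ≤ l x * M₁ * Real.exp ((R + 1) * |τ x|) := by gcongr
        _ = _ := by ring
    · rw [norm_mul, norm_mul, norm_mul, Complex.norm_real, Real.norm_of_nonneg e0]
      calc l x * (l x * ‖deriv expQuot (z.2 * l x)‖) * ‖Complex.exp (z.1 * τ x)‖
          ≤ l x * (B * M₂) * Real.exp (R * |τ x|) := by gcongr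
        _ ≤ l x * (B * M₂) * Real.exp ((R + 1) * |τ x|) := by gcongr
        _ = _ := by ring
  · have g1 : HasFDerivAt (fun z : ℂ × ℂ => z.1) (ContinuousLinearMap.fst ℂ ℂ ℂ) z := hasFDerivAt_fst
    have g2 : HasFDerivAt (fun z : ℂ × ℂ => z.2) (ContinuousLinearMap.snd ℂ ℂ ℂ) z := hasFDerivAt_snd
    have d1 : HasFDerivAt (fun z : ℂ × ℂ => expQuot (z.2 * l x)) _ z :=
      (hψ (z.2 * l x)).hasDerivAt.comp_hasFDerivAt z (g2.mul_const (l x : ℂ))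
    have d2 : HasFDerivAt (fun z : ℂ × ℂ => Complex.exp (z.1 * τ x)) _ z :=
      (g1.mul_const (τ x : ℂ)).cexp
    refine ((d1.const_mul (l x : ℂ)).mul d2).congr_fderiv ?_
    refine ContinuousLinearMap.ext fun y => ?_
    simp [F']
    ring

/-- A Young-type inequality with exponents `1 + ε` and `1 + 1/ε` separates `a` from `τ`. It holds
with constants `1`: if `t ≤ ‖a‖^ε` the first power dominates `‖a‖ t`, otherwise `‖a‖ ≤ t^(1/ε)` and
the second does. -/
theorem exists_norm_expTransform_le (h0 : ∀ x, 0 ≤ l x)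
    {B : ℝ} (hB : ∀ x, l x ≤ B)
    (hint : ∀ p : ℝ, 0 < p → Integrable (fun x => l x * Real.exp (|τ x| ^ p)) μ)
    (w : ℂ) {ε : ℝ} (hε : 0 < ε) :
    ∃ C, 0 ≤ C ∧ ∀ a : ℂ, ‖expTransform μ l τ a w‖ ≤ C * Real.exp (‖a‖ ^ (1 + ε)) := by
  obtain ⟨M, hM0, hM⟩ := exists_bound_closedBall differentiable_expQuot.continuous (‖w‖ * B)
  have hp : 0 < 1 + 1 / ε := by positivity
  refine ⟨M * ∫ x, l x * Real.exp (|τ x| ^ (1 + 1 / ε)) ∂μ,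
    mul_nonneg hM0 (integral_nonneg fun x => mul_nonneg (h0 x) (Real.exp_pos _).le), fun a => ?_⟩
  have key : ∀ t : ℝ, 0 ≤ t → ‖a‖ * t ≤ ‖a‖ ^ (1 + ε) + t ^ (1 + 1 / ε) := by
    intro t ht
    have ha := norm_nonneg a
    rw [Real.rpow_add_of_nonneg ha zero_le_one hε.le, Real.rpow_one,
      Real.rpow_add_of_nonneg ht zero_le_one (by positivity), Real.rpow_one]
    rcases le_total t (‖a‖ ^ ε) with h | h
    · have : 0 ≤ t * t ^ (1 / ε) := by positivity
      nlinarith [mul_le_mul_of_nonneg_left h ha]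
    · have h' : ‖a‖ ≤ t ^ (1 / ε) := by
        calc ‖a‖ = (‖a‖ ^ ε) ^ (1 / ε) := by
              rw [← Real.rpow_mul ha, mul_one_div_cancel hε.ne', Real.rpow_one]
          _ ≤ _ := Real.rpow_le_rpow (by positivity) h (by positivity)
      have : 0 ≤ ‖a‖ * ‖a‖ ^ ε := by positivity
      nlinarith [mul_le_mul_of_nonneg_left h' ht]
  rw [mul_assoc, mul_comm (integral _ _), ← integral_const_mul, ← integral_const_mul]
  refine norm_integral_le_of_norm_le (((hint _ hp).const_mul _).const_mul _)
    (ae_of_all _ fun x => ?_)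
  rw [norm_mul, norm_mul, Complex.norm_real, Real.norm_of_nonneg (h0 x)]
  have e1 : ‖expQuot (w * l x)‖ ≤ M := by
    refine hM _ ?_
    rw [norm_mul, Complex.norm_real, Real.norm_of_nonneg (h0 x)]
    exact mul_le_mul_of_nonneg_left (hB x) (norm_nonneg _)
  have e2 : ‖Complex.exp (a * τ x)‖ ≤
      Real.exp (‖a‖ ^ (1 + ε)) * Real.exp (|τ x| ^ (1 + 1 / ε)) := by
    rw [← Real.exp_add]
    exact (norm_exp_mul_le a _).trans (Real.exp_le_exp.mpr (key _ (abs_nonneg _)))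
  have e0 := h0 x
  calc l x * ‖expQuot (w * l x)‖ * ‖Complex.exp (a * τ x)‖
      ≤ l x * M * (Real.exp (‖a‖ ^ (1 + ε)) * Real.exp (|τ x| ^ (1 + 1 / ε))) := by gcongr
    _ = _ := by ring

end Transform

/-- `exp (t ^ p)` is dominated by the reciprocal of a double exponential. -/
theorem integrableOn_exp_rpow_mul_exp_neg_exp {c κ p : ℝ} (hc : 0 < c) (hκ : 0 < κ) (hp : 0 < p) :
    IntegrableOn (fun t : ℝ => Real.exp (-(c * Real.exp (κ * |t|))) * Real.exp (|t| ^ p))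
      univ := by
  have hcont : Continuous fun t : ℝ =>
      Real.exp (-(c * Real.exp (κ * |t|))) * Real.exp (|t| ^ p) := by
    have : Continuous fun t : ℝ => |t| ^ p := continuous_abs.rpow_const fun _ => Or.inr hp.le
    fun_prop
  have hIoi : IntegrableOn (fun t : ℝ =>
      Real.exp (-(c * Real.exp (κ * |t|))) * Real.exp (|t| ^ p)) (Ioi 0) := by
    refine integrable_of_isBigO_exp_neg (b := 1) one_pos hcont.continuousOn ?_
    -- Eventually `t ^ p` and `t` are each at most half of `c * exp (κ t)`: one half cancels the
    -- growing factor, the other leaves a bound by `exp (-t)`.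
    have h1 : (fun t : ℝ => t ^ p) =o[atTop] fun t => Real.exp (κ * t) :=
      isLittleO_rpow_exp_pos_mul_atTop p hκ
    have h2 : (fun t : ℝ => t ^ (1 : ℝ)) =o[atTop] fun t => Real.exp (κ * t) :=
      isLittleO_rpow_exp_pos_mul_atTop 1 hκ
    refine Asymptotics.IsBigO.of_bound 1 ?_
    filter_upwards [h1.bound (half_pos hc), h2.bound (half_pos hc), eventually_ge_atTop 0]
      with t e1 e2 ht
    rw [abs_of_nonneg ht, ← Real.exp_add, Real.norm_of_nonneg (Real.exp_pos _).le,
      Real.norm_of_nonneg (Real.exp_pos _).le, one_mul]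
    rw [Real.norm_of_nonneg (by positivity), Real.norm_of_nonneg (Real.exp_pos _).le] at e1 e2
    rw [Real.rpow_one] at e2
    exact Real.exp_le_exp.mpr (by linarith)
  have hIic : IntegrableOn (fun t : ℝ =>
      Real.exp (-(c * Real.exp (κ * |t|))) * Real.exp (|t| ^ p)) (Iic 0) := by
    rw [← integrableOn_Ici_iff_integrableOn_Ioi] at hIoi
    rw [← neg_zero (G := ℝ)] at hIoi
    simpa using hIoi.comp_neg_Iic
  rw [← Iic_union_Ioi (a := (0 : ℝ))]
  exact hIic.union hIoi

/-! ### Splitting the integrand at the sign of `y` -/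

section LogHalf

variable {X : Type*} {y α β : X → ℝ}

variable (y α β) in
/-- `log α` on the half `y ≤ 0`. -/
def logLower (x : X) : ℝ := if y x ≤ 0 then Real.log (α x) else 0

variable (y α β) in
/-- `log β` on the half `0 < y`. -/
def logUpper (x : X) : ℝ := if 0 < y x then Real.log (β x) else 0

theorem logLower_nonneg (hα1 : ∀ x, 1 ≤ α x) (x : X) : 0 ≤ logLower y α x := by
  unfold logLower
  split_ifs
  exacts [Real.log_nonneg (hα1 x), le_rfl]

theorem logUpper_nonneg (hβ1 : ∀ x, 1 ≤ β x) (x : X) : 0 ≤ logUpper y β x := by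
  unfold logUpper
  split_ifs
  exacts [Real.log_nonneg (hβ1 x), le_rfl]

variable {C c κ : ℝ}

theorem logLower_le (hC : 0 ≤ C) (hα1 : ∀ x, 1 ≤ α x)
    (hα' : ∀ x, y x ≤ 0 → α x ≤ 1 + C * Real.exp (-(c * Real.exp (κ * |y x|)))) (x : X) :
    logLower y α x ≤ C * Real.exp (-(c * Real.exp (κ * |y x|))) := by
  unfold logLower
  split_ifs with h
  · linarith [hα' x h, Real.log_le_sub_one_of_pos (one_pos.trans_le (hα1 x))]
  · positivity

theorem logUpper_le (hC : 0 ≤ C) (hβ1 : ∀ x, 1 ≤ β x)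
    (hβ' : ∀ x, 0 < y x → β x ≤ 1 + C * Real.exp (-(c * Real.exp (κ * |y x|)))) (x : X) :
    logUpper y β x ≤ C * Real.exp (-(c * Real.exp (κ * |y x|))) := by
  unfold logUpper
  split_ifs with h
  · linarith [hβ' x h, Real.log_le_sub_one_of_pos (one_pos.trans_le (hβ1 x))]
  · positivity

/-- Since `log α = log β + y`, the exponent `s log α + (w - s) log β` equals `w log α + (s - w) y`
and also `w log β + s y`. On each half the small logarithm is kept, and `exp (w l) = 1 + w l ψ(w l)`
isolates a pure exponential in `y` and a remainder divisible by `w`. -/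
theorem cpow_mul_cpow_eq (hα1 : ∀ x, 1 ≤ α x) (hβ1 : ∀ x, 1 ≤ β x)
    (hαβ : ∀ x, α x = β x * Real.exp (y x)) (s w : ℂ) (x : X) :
    (α x : ℂ) ^ s * (β x : ℂ) ^ (w - s) =
      (indicator (Iic 0) (fun u : ℝ => Complex.exp ((s - w) * u)) (y x) +
        indicator (Ioi 0) (fun u : ℝ => Complex.exp (s * u)) (y x)) +
      w * ((logLower y α x : ℂ) * expQuot (w * logLower y α x) * Complex.exp ((s - w) * y x) +
        (logUpper y β x : ℂ) * expQuot (w * logUpper y β x) * Complex.exp (s * y x)) := by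
  have a0 : 0 < α x := one_pos.trans_le (hα1 x)
  have b0 : 0 < β x := one_pos.trans_le (hβ1 x)
  have hlog : Real.log (α x) = Real.log (β x) + y x := by
    rw [hαβ x, Real.log_mul b0.ne' (Real.exp_pos _).ne', Real.log_exp]
  have key : ∀ z e : ℂ, w * (z * expQuot (w * z) * e) = (Complex.exp (w * z) - 1) * e := by
    intro z e
    rw [← mul_expQuot]
    ring
  rw [Complex.cpow_def_of_ne_zero (by exact_mod_cast a0.ne'),
    Complex.cpow_def_of_ne_zero (by exact_mod_cast b0.ne'), ← Complex.ofReal_log a0.le,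
    ← Complex.ofReal_log b0.le, mul_add, key, key, ← Complex.exp_add]
  rcases le_or_gt (y x) 0 with h | h
  · simp only [indicator, mem_Ioi, mem_Iic, h, h.not_gt, if_true, if_false, logLower, logUpper]
    rw [Complex.ofReal_zero, mul_zero, Complex.exp_zero, sub_self, zero_mul, add_zero, add_zero,
      sub_mul (Complex.exp _) 1, one_mul, ← Complex.exp_add, add_sub_cancel, hlog]
    push_cast
    ring_nf
  · simp only [indicator, mem_Ioi, mem_Iic, h, h.not_ge, if_true, if_false, logLower, logUpper]
    rw [Complex.ofReal_zero, mul_zero, Complex.exp_zero, sub_self, zero_mul, zero_add, zero_add,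
      sub_mul, one_mul, ← Complex.exp_add, add_sub_cancel, hlog]
    push_cast
    ring_nf

end LogHalf

/-! ### Integrals over a space on which `y` is distributed as a multiple of Lebesgue measure -/

section Pair

variable {X : Type*} [MeasurableSpace X] {μ : Measure X} {y α β : X → ℝ} {V : NNReal}

theorem integrable_comp_of_map_eq {E : Type*} [NormedAddCommGroup E] (hy : Measurable y)
    (hV : μ.map y = V • (volume : Measure ℝ)) {g : ℝ → E} (hg : Integrable g) :
    Integrable (fun x => g (y x)) μ := by
  have : Integrable g (μ.map y) := hV ▸ hg.smul_measure_nnreal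
  exact this.comp_measurable hy

theorem integral_comp_of_map_eq {g : ℝ → ℂ} (hy : Measurable y)
    (hV : μ.map y = V • (volume : Measure ℝ)) (hg : Integrable g) :
    ∫ x, g (y x) ∂μ = (V : ℂ) * ∫ t, g t := by
  have : Integrable g (μ.map y) := hV ▸ hg.smul_measure_nnreal
  rw [← integral_map hy.aemeasurable this.aestronglyMeasurable, hV, integral_smul_nnreal_measure]
  rfl

/-- No decay estimate is needed. For `y ≤ 0` the bound `α ≥ 1` forces `β ≥ exp (-y)`, for `y > 0`
the bound `β ≥ 1` forces `α ≥ exp y`; with negative real parts the integrand decays exponentially in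
`|y|`. -/
theorem integrable_cpow_mul_cpow (hy : Measurable y) (hV : μ.map y = V • (volume : Measure ℝ))
    (hα : Measurable α) (hβ : Measurable β) (hα1 : ∀ x, 1 ≤ α x) (hβ1 : ∀ x, 1 ≤ β x)
    (hαβ : ∀ x, α x = β x * Real.exp (y x)) {s t : ℂ} (hs : s.re < 0) (ht : t.re < 0) :
    Integrable (fun x => (α x : ℂ) ^ s * (β x : ℂ) ^ t) μ := by
  have i1 : Integrable (indicator (Ioi 0) fun u : ℝ => Real.exp (s.re * u)) :=
    (integrableOn_exp_mul_Ioi hs 0).integrable_indicator measurableSet_Ioi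
  have i2 : Integrable (indicator (Iic 0) fun u : ℝ => Real.exp (-t.re * u)) :=
    (integrableOn_exp_mul_Iic (neg_pos.mpr ht) 0).integrable_indicator measurableSet_Iic
  refine ((integrable_comp_of_map_eq hy hV i1).add (integrable_comp_of_map_eq hy hV i2)).mono'
    (by fun_prop) (ae_of_all _ fun x => ?_)
  have a0 : 0 < α x := one_pos.trans_le (hα1 x)
  have b0 : 0 < β x := one_pos.trans_le (hβ1 x)
  rw [norm_mul, Complex.norm_cpow_eq_rpow_re_of_pos a0, Complex.norm_cpow_eq_rpow_re_of_pos b0]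
  have a1 : α x ^ s.re ≤ 1 := Real.rpow_le_one_of_one_le_of_nonpos (hα1 x) hs.le
  have b1 : β x ^ t.re ≤ 1 := Real.rpow_le_one_of_one_le_of_nonpos (hβ1 x) ht.le
  rcases le_or_gt (y x) 0 with h | h
  · have e : Real.exp (-y x) ≤ β x := by
      have := hα1 x
      rw [hαβ x] at this
      rw [Real.exp_neg, inv_le_iff_one_le_mul₀ (Real.exp_pos _)]
      exact this
    have := Real.rpow_le_rpow_of_nonpos (Real.exp_pos _) e ht.le
    rw [← Real.exp_mul] at this
    simp only [Pi.add_apply, indicator, mem_Ioi, mem_Iic, h, h.not_gt, if_true, if_false, zero_add]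
    calc α x ^ s.re * β x ^ t.re ≤ 1 * Real.exp (-y x * t.re) := by gcongr
      _ = _ := by rw [one_mul]; ring_nf
  · have e : Real.exp (y x) ≤ α x := by
      rw [hαβ x]
      exact le_mul_of_one_le_left (Real.exp_pos _).le (hβ1 x)
    have := Real.rpow_le_rpow_of_nonpos (Real.exp_pos _) e hs.le
    rw [← Real.exp_mul] at this
    simp only [Pi.add_apply, indicator, mem_Ioi, mem_Iic, h, h.not_ge, if_true, if_false, add_zero]
    calc α x ^ s.re * β x ^ t.re ≤ Real.exp (y x * s.re) * 1 := by gcongr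
      _ = _ := by rw [mul_one, mul_comm]

theorem measurable_logLower (hy : Measurable y) (hα : Measurable α) : Measurable (logLower y α) :=
  Measurable.ite (measurableSet_le hy measurable_const) hα.log measurable_const

theorem measurable_logUpper (hy : Measurable y) (hβ : Measurable β) : Measurable (logUpper y β) :=
  Measurable.ite (measurableSet_lt measurable_const hy) hβ.log measurable_const

variable {C c κ : ℝ}

theorem integrable_mul_exp_abs_rpow (hy : Measurable y) (hV : μ.map y = V • (volume : Measure ℝ))
    {l : X → ℝ} (hl : Measurable l) (h0 : ∀ x, 0 ≤ l x) (hc : 0 < c) (hκ : 0 < κ)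
    (hle : ∀ x, l x ≤ C * Real.exp (-(c * Real.exp (κ * |y x|)))) {p : ℝ} (hp : 0 < p) :
    Integrable (fun x => l x * Real.exp (|y x| ^ p)) μ := by
  have hi := integrableOn_exp_rpow_mul_exp_neg_exp hc hκ hp
  rw [integrableOn_univ] at hi
  refine ((integrable_comp_of_map_eq hy hV hi).const_mul C).mono' ?_ (ae_of_all _ fun x => ?_)
  · exact (hl.mul (Real.measurable_exp.comp (hy.abs.pow_const p))).aestronglyMeasurable
  · rw [Real.norm_of_nonneg (mul_nonneg (h0 x) (Real.exp_pos _).le), ← mul_assoc]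
    exact mul_le_mul_of_nonneg_right (hle x) (Real.exp_pos _).le

theorem le_of_le_mul_exp_neg_exp (hC : 0 ≤ C) (hc : 0 < c) {l t : ℝ}
    (h : l ≤ C * Real.exp (-(c * Real.exp (κ * t)))) : l ≤ C := by
  refine h.trans (mul_le_of_le_one_right hC (Real.exp_le_one_iff.mpr ?_))
  have := Real.exp_pos (κ * t)
  nlinarith

theorem integrable_expTransform {l τ : X → ℝ} (hl : Measurable l) (hτ : Measurable τ)
    (h0 : ∀ x, 0 ≤ l x) {B : ℝ} (hB : ∀ x, l x ≤ B)
    (hint : Integrable (fun x => l x * Real.exp (|τ x| ^ (2 : ℝ))) μ) (a w : ℂ) :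
    Integrable (fun x => (l x : ℂ) * expQuot (w * l x) * Complex.exp (a * τ x)) μ := by
  obtain ⟨M, hM0, hM⟩ := exists_bound_closedBall differentiable_expQuot.continuous (‖w‖ * B)
  refine ((integrable_mul_exp_mul_abs hl hτ h0 hint ‖a‖).const_mul M).mono' ?_
    (ae_of_all _ fun x => ?_)
  · exact ((((by fun_prop : Measurable fun x => (l x : ℂ)).mul
      (differentiable_expQuot.continuous.measurable.comp (by fun_prop))).mul
        (by fun_prop))).aestronglyMeasurable
  · rw [norm_mul, norm_mul, Complex.norm_real, Real.norm_of_nonneg (h0 x)]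
    have e1 : ‖expQuot (w * l x)‖ ≤ M := by
      refine hM _ ?_
      rw [norm_mul, Complex.norm_real, Real.norm_of_nonneg (h0 x)]
      exact mul_le_mul_of_nonneg_left (hB x) (norm_nonneg _)
    have e2 := norm_exp_mul_le a (τ x)
    have e0 := h0 x
    calc l x * ‖expQuot (w * l x)‖ * ‖Complex.exp (a * τ x)‖
        ≤ l x * M * Real.exp (‖a‖ * |τ x|) := by gcongr
      _ = _ := by ring

/-- The pure exponentials integrate to `1 / (s - w)` over `y ≤ 0` and `-1 / s` over `y > 0`; their
sum is again divisible by `w`, so `w` factors out of the whole integral. -/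
theorem integral_cpow_mul_cpow (hy : Measurable y) (hV : μ.map y = V • (volume : Measure ℝ))
    (hα : Measurable α) (hβ : Measurable β) (hα1 : ∀ x, 1 ≤ α x) (hβ1 : ∀ x, 1 ≤ β x)
    (hαβ : ∀ x, α x = β x * Real.exp (y x)) (hC : 0 ≤ C) (hc : 0 < c) (hκ : 0 < κ)
    (hα' : ∀ x, y x ≤ 0 → α x ≤ 1 + C * Real.exp (-(c * Real.exp (κ * |y x|))))
    (hβ' : ∀ x, 0 < y x → β x ≤ 1 + C * Real.exp (-(c * Real.exp (κ * |y x|))))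
    {s w : ℂ} (hws : w.re < s.re) (hs : s.re < 0) :
    ∫ x, (α x : ℂ) ^ s * (β x : ℂ) ^ (w - s) ∂μ =
      w * (V / (s * (s - w)) + (expTransform μ (logLower y α) y (s - w) w +
        expTransform μ (logUpper y β) y s w)) := by
  have hsw : 0 < (s - w).re := by simpa using hws
  have i1 : Integrable (indicator (Ioi 0) fun u : ℝ => Complex.exp (s * u)) :=
    (integrableOn_exp_mul_complex_Ioi hs 0).integrable_indicator measurableSet_Ioi
  have i2 : Integrable (indicator (Iic 0) fun u : ℝ => Complex.exp ((s - w) * u)) :=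
    (integrableOn_exp_mul_complex_Iic hsw 0).integrable_indicator measurableSet_Iic
  have i3 := integrable_expTransform (measurable_logLower hy hα) hy (logLower_nonneg hα1)
    (fun x => le_of_le_mul_exp_neg_exp hC hc (logLower_le hC hα1 hα' x))
    (integrable_mul_exp_abs_rpow hy hV (measurable_logLower hy hα) (logLower_nonneg hα1) hc hκ
      (logLower_le hC hα1 hα') two_pos) (s - w) w
  have i4 := integrable_expTransform (measurable_logUpper hy hβ) hy (logUpper_nonneg hβ1)
    (fun x => le_of_le_mul_exp_neg_exp hC hc (logUpper_le hC hβ1 hβ' x))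
    (integrable_mul_exp_abs_rpow hy hV (measurable_logUpper hy hβ) (logUpper_nonneg hβ1) hc hκ
      (logUpper_le hC hβ1 hβ') two_pos) s w
  have j1 := integrable_comp_of_map_eq hy hV i1
  have j2 := integrable_comp_of_map_eq hy hV i2
  simp_rw [cpow_mul_cpow_eq hα1 hβ1 hαβ s w]
  have k1 : Integrable (fun x => indicator (Iic 0) (fun u : ℝ => Complex.exp ((s - w) * u)) (y x) +
      indicator (Ioi 0) (fun u : ℝ => Complex.exp (s * u)) (y x)) μ := j2.add j1
  have k2 : Integrable (fun x => w * ((logLower y α x : ℂ) * expQuot (w * logLower y α x) *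
      Complex.exp ((s - w) * y x) +
        (logUpper y β x : ℂ) * expQuot (w * logUpper y β x) * Complex.exp (s * y x))) μ :=
    (i3.add i4).const_mul w
  rw [integral_add k1 k2, integral_add j2 j1, integral_const_mul,
    integral_add i3 i4, integral_comp_of_map_eq hy hV i1, integral_comp_of_map_eq hy hV i2,
    integral_indicator measurableSet_Ioi, integral_indicator measurableSet_Iic,
    integral_exp_mul_complex_Ioi hs, integral_exp_mul_complex_Iic hsw]
  have hs0 : s ≠ 0 := fun h => by simp [h] at hs
  have hsw0 : s - w ≠ 0 := fun h => by simp [h] at hsw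
  simp only [expTransform, Complex.ofReal_zero, mul_zero, Complex.exp_zero]
  field_simp
  ring

end Pair

end ArakelovZeta

namespace ArakelovZeta

open MeasureTheory Set Filter Topology

set_option linter.unusedSectionVars false

/-! ### Poisson summation in several variables for functions of Gaussian decay -/

section Poisson

variable {ι : Type*} [Fintype ι]

/-- Any finite set of integer vectors lies in a box, over which the sum factors into one-variable
sums. -/
theorem summable_prod_of_nonneg {g : ℤ → ℝ} (hg0 : ∀ n, 0 ≤ g n) (hg : Summable g) :
    Summable fun m : ι → ℤ => ∏ i, g (m i) := by
  classical
  refine summable_of_sum_le (c := (∑' n, g n) ^ Fintype.card ι)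
    (fun m => Finset.prod_nonneg fun i _ => hg0 _) fun u => ?_
  have hsub : u ⊆ Fintype.piFinset fun i => u.image fun m => m i := fun m hm =>
    Fintype.mem_piFinset.mpr fun i => Finset.mem_image_of_mem _ hm
  calc ∑ m ∈ u, ∏ i, g (m i)
      ≤ ∑ m ∈ Fintype.piFinset fun i => u.image fun m => m i, ∏ i, g (m i) :=
        Finset.sum_le_sum_of_subset_of_nonneg hsub fun m _ _ => Finset.prod_nonneg fun i _ => hg0 _
    _ = ∏ i, ∑ n ∈ u.image fun m => m i, g n := by
        rw [Finset.prod_univ_sum]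
    _ ≤ ∏ _i : ι, ∑' n, g n := Finset.prod_le_prod
        (fun i _ => Finset.sum_nonneg fun n _ => hg0 n)
        fun i _ => hg.sum_le_tsum _ fun n _ => hg0 n
    _ = _ := by simp

theorem summable_exp_neg_mul_sq {c : ℝ} (hc : 0 < c) :
    Summable fun n : ℤ => Real.exp (-(c * (n : ℝ) ^ 2)) := by
  have h : Summable fun n : ℕ => Real.exp (n * -c) :=
    Real.summable_exp_nat_mul_iff.mpr (neg_lt_zero.mpr hc)
  have h' : Summable fun n : ℕ => Real.exp (-(c * (n : ℝ) ^ 2)) := by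
    refine h.of_nonneg_of_le (fun _ => (Real.exp_pos _).le) fun n => Real.exp_le_exp.mpr ?_
    have : (n : ℝ) ≤ (n : ℝ) ^ 2 := by exact_mod_cast Nat.le_self_pow two_ne_zero n
    nlinarith
  refine Summable.of_nat_of_neg (by simpa using h') (by simpa using h')

theorem summable_exp_neg_mul_sum_sq {c : ℝ} (hc : 0 < c) :
    Summable fun m : ι → ℤ => Real.exp (-(c * ∑ i, (m i : ℝ) ^ 2)) := by
  refine (summable_prod_of_nonneg (ι := ι) (g := fun n => Real.exp (-(c * (n : ℝ) ^ 2)))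
    (fun n => (Real.exp_pos _).le) (summable_exp_neg_mul_sq hc)).congr fun m => ?_
  rw [← Real.exp_sum, Finset.mul_sum, Finset.sum_neg_distrib]

theorem integrable_exp_neg_mul_sum_sq {c : ℝ} (hc : 0 < c) :
    Integrable fun x : ι → ℝ => Real.exp (-(c * ∑ i, x i ^ 2)) := by
  have := Integrable.fintype_prod (ι := ι) (f := fun _ (t : ℝ) => Real.exp (-c * t ^ 2))
    (μ := fun _ => volume) fun _ => integrable_exp_neg_mul_sq hc
  refine this.congr (ae_of_all _ fun x => ?_)
  simp only
  rw [← Real.exp_sum, Finset.mul_sum, ← Finset.sum_neg_distrib]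
  simp

/-- From `(x + m)² ≥ m²/2 - x²`. The majorant does not depend on `x` in a bounded set, which makes
the periodization converge locally uniformly. -/
theorem exp_neg_sum_add_sq_le {c R : ℝ} (hc : 0 < c) {x : ι → ℝ} (hx : ∀ i, |x i| ≤ R)
    (m : ι → ℤ) :
    Real.exp (-(c * ∑ i, (x i + m i) ^ 2)) ≤
      Real.exp (c * (Fintype.card ι * R ^ 2)) * Real.exp (-(c / 2 * ∑ i, (m i : ℝ) ^ 2)) := by
  rw [← Real.exp_add]
  refine Real.exp_le_exp.mpr ?_
  have : ∑ i, ((m i : ℝ) ^ 2 / 2 - R ^ 2) ≤ ∑ i, (x i + m i) ^ 2 := by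
    refine Finset.sum_le_sum fun i _ => ?_
    have := sq_abs (x i)
    have h2 : |x i| ^ 2 ≤ R ^ 2 := pow_le_pow_left₀ (abs_nonneg _) (hx i) 2
    nlinarith [sq_nonneg (2 * x i + m i)]
  rw [Finset.sum_sub_distrib, ← Finset.sum_div, Finset.sum_const, nsmul_eq_mul,
    Finset.card_univ] at this
  nlinarith

/-- The half-open unit cube with lower corner `m`. -/
def unitCube (m : ι → ℝ) : Set (ι → ℝ) := {x | ∀ i, x i ∈ Ioc (m i) (m i + 1)}

theorem measurableSet_unitCube (m : ι → ℝ) : MeasurableSet (unitCube m) := by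
  have : unitCube m = univ.pi fun i => Ioc (m i) (m i + 1) := by
    ext x
    simp [unitCube]
  rw [this]
  exact MeasurableSet.univ_pi fun i => measurableSet_Ioc

theorem iUnion_unitCube : ⋃ m : ι → ℤ, unitCube (fun i => (m i : ℝ)) = univ := by
  -- The cubes are open below and closed above, so the corner of the cube containing `x` is `⌈x⌉ -
  -- 1` and not the floor.
  refine eq_univ_of_forall fun x => mem_iUnion.mpr ⟨fun i => ⌈x i⌉ - 1, fun i => ?_⟩
  push_cast
  constructor
  · linarith [Int.ceil_lt_add_one (x i)]
  · linarith [Int.le_ceil (x i)]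

theorem pairwise_disjoint_unitCube :
    Pairwise (Function.onFun Disjoint fun m : ι → ℤ => unitCube fun i => (m i : ℝ)) := by
  intro m m' hne
  refine disjoint_left.mpr fun x hx hx' => hne (funext fun i => ?_)
  obtain ⟨h1, h2⟩ := hx i
  obtain ⟨h3, h4⟩ := hx' i
  have e1 : (m i : ℝ) < m' i + 1 := by linarith
  have e2 : (m' i : ℝ) < m i + 1 := by linarith
  have e1' : m i < m' i + 1 := by exact_mod_cast e1
  have e2' : m' i < m i + 1 := by exact_mod_cast e2
  omega

theorem setIntegral_unitCube_eq (g : (ι → ℝ) → ℂ) (m : ι → ℝ) :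
    ∫ x in unitCube m, g x = ∫ x in unitCube (0 : ι → ℝ), g (x + m) := by
  have h := (measurePreserving_add_right volume m).setIntegral_preimage_emb
    (MeasurableEquiv.addRight m).measurableEmbedding g (unitCube m)
  rw [← h]
  congr 2
  ext x
  simp only [unitCube, mem_preimage, mem_ofPred_eq, Pi.add_apply, Pi.zero_apply, mem_Ioc]
  refine forall_congr' fun i => ?_
  constructor <;> rintro ⟨h1, h2⟩ <;> constructor <;> linarith

theorem integral_eq_tsum_unitCube {g : (ι → ℝ) → ℂ} (hg : Integrable g) :
    ∫ x, g x = ∑' m : ι → ℤ, ∫ x in unitCube (0 : ι → ℝ), g (x + fun i => (m i : ℝ)) := by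
  rw [← setIntegral_univ, ← iUnion_unitCube (ι := ι),
    integral_iUnion (fun m => measurableSet_unitCube _) pairwise_disjoint_unitCube
      hg.integrableOn]
  exact tsum_congr fun m => setIntegral_unitCube_eq g _

variable {f : (ι → ℝ) → ℂ} {C c : ℝ}

theorem norm_add_le_of_gaussian (hc : 0 < c) (hC : 0 ≤ C)
    (hb : ∀ x, ‖f x‖ ≤ C * Real.exp (-(c * ∑ i, x i ^ 2))) {R : ℝ} {x : ι → ℝ}
    (hx : ∀ i, |x i| ≤ R) (m : ι → ℤ) :
    ‖f (x + fun i => (m i : ℝ))‖ ≤ C * (Real.exp (c * (Fintype.card ι * R ^ 2)) *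
      Real.exp (-(c / 2 * ∑ i, (m i : ℝ) ^ 2))) :=
  (hb _).trans (mul_le_mul_of_nonneg_left (exp_neg_sum_add_sq_le hc hx m) hC)

theorem summable_gaussian_majorant (hc : 0 < c) (C D : ℝ) :
    Summable fun m : ι → ℤ => C * (D * Real.exp (-(c / 2 * ∑ i, (m i : ℝ) ^ 2))) :=
  ((summable_exp_neg_mul_sum_sq (half_pos hc)).mul_left _).mul_left _

variable (f) in
/-- The periodization of a function on `ℝ^ι`. -/
def periodize (x : ι → ℝ) : ℂ := ∑' m : ι → ℤ, f (x + fun i => (m i : ℝ))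

theorem continuous_periodize (hf : Continuous f) (hc : 0 < c) (hC : 0 ≤ C)
    (hb : ∀ x, ‖f x‖ ≤ C * Real.exp (-(c * ∑ i, x i ^ 2))) : Continuous (periodize f) := by
  refine continuous_iff_continuousAt.mpr fun x₀ => ?_
  have : ContinuousOn (periodize f) (Metric.ball 0 (‖x₀‖ + 1)) := by
    refine continuousOn_tsum (fun m => (by fun_prop : Continuous _).continuousOn)
      (summable_gaussian_majorant hc C (Real.exp (c * (Fintype.card ι * (‖x₀‖ + 1) ^ 2))))
      fun m x hx => norm_add_le_of_gaussian hc hC hb (fun i => ?_) m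
    rw [mem_ball_zero_iff] at hx
    exact (norm_le_pi_norm x i).trans hx.le
  exact this.continuousAt (Metric.isOpen_ball.mem_nhds (by simp))

theorem periodize_add (x : ι → ℝ) (n : ι → ℤ) :
    periodize f (x + fun i => (n i : ℝ)) = periodize f x := by
  unfold periodize
  rw [← (Equiv.addLeft n).tsum_eq fun m : ι → ℤ => f (x + fun i => (m i : ℝ))]
  refine tsum_congr fun m => congrArg f ?_
  ext i
  simp [add_assoc]

/-- The projection `ℝ^ι → (ℝ/ℤ)^ι`. -/
def toTorus (x : ι → ℝ) : UnitAddTorus ι := fun i => (x i : UnitAddCircle)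

theorem isOpenQuotientMap_toTorus : IsOpenQuotientMap (toTorus (ι := ι)) :=
  IsOpenQuotientMap.piMap fun _ => QuotientAddGroup.isOpenQuotientMap_mk

variable (f) in
/-- The periodization as a function on the torus. -/
def torusPeriodize (t : UnitAddTorus ι) : ℂ :=
  periodize f (Function.surjInv isOpenQuotientMap_toTorus.surjective t)

/-- The lift chosen by `surjInv` is arbitrary, but it differs from `x` by an integer vector, and
`periodize` does not see that. -/
theorem torusPeriodize_toTorus (x : ι → ℝ) : torusPeriodize f (toTorus x) = periodize f x := by
  unfold torusPeriodize
  set z := Function.surjInv isOpenQuotientMap_toTorus.surjective (toTorus x) with hz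
  have h : toTorus z = toTorus x := Function.surjInv_eq _ _
  have h' : ∀ i, ∃ n : ℤ, z i = x i + n := by
    intro i
    have := congrFun h i
    obtain ⟨n, hn⟩ := (AddCircle.coe_eq_zero_iff (1 : ℝ) (x := z i - x i)).mp (by
      rw [AddCircle.coe_sub]
      exact sub_eq_zero.mpr this)
    exact ⟨n, by rw [zsmul_one] at hn; linarith⟩
  choose n hn using h'
  rw [← periodize_add x n]
  congr 1
  ext i
  exact hn i

variable (f) in
/-- The Fourier transform on `ℝ^ι`, at an integral frequency. -/
def fourierAt (n : ι → ℤ) : ℂ :=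
  ∫ x : ι → ℝ, Complex.exp (-(2 * Real.pi * Complex.I * ∑ i, (n i : ℂ) * x i)) * f x

theorem mFourier_neg_toTorus (n : ι → ℤ) (x : ι → ℝ) :
    UnitAddTorus.mFourier (-n) (toTorus x) =
      Complex.exp (-(2 * Real.pi * Complex.I * ∑ i, (n i : ℂ) * x i)) := by
  simp only [UnitAddTorus.mFourier, toTorus, ContinuousMap.coe_mk, fourier_coe_apply,
    ← Complex.exp_sum, Pi.neg_apply, Finset.mul_sum, ← Finset.sum_neg_distrib]
  refine congrArg _ (Finset.sum_congr rfl fun i _ => ?_)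
  push_cast
  ring

/-- Unfolding: the character is invariant under integer translations, so the integral over the unit
cube of the sum of translates is a sum over all translated cubes, which tile `ℝ^ι`. -/
theorem mFourierCoeff_torusPeriodize (hf : Continuous f) (hc : 0 < c) (hC : 0 ≤ C)
    (hb : ∀ x, ‖f x‖ ≤ C * Real.exp (-(c * ∑ i, x i ^ 2))) (n : ι → ℤ) :
    UnitAddTorus.mFourierCoeff (torusPeriodize f) n = fourierAt f n := by
  let e : (ι → ℝ) → ℂ := fun x => UnitAddTorus.mFourier (-n) (toTorus x)
  have hec : Continuous e :=
    (map_continuous _).comp (isOpenQuotientMap_toTorus (ι := ι)).continuous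
  have he1 : ∀ x, ‖e x‖ = 1 := by
    intro x
    simp [e, UnitAddTorus.mFourier, norm_prod, Circle.norm_coe]
  have heper : ∀ (x : ι → ℝ) (m : ι → ℤ), e (x + fun i => (m i : ℝ)) = e x := by
    intro x m
    refine congrArg (UnitAddTorus.mFourier (-n)) (funext fun i => ?_)
    have h0 := (AddCircle.coe_eq_zero_iff (1 : ℝ) (x := (m i : ℝ))).mpr ⟨m i, by simp⟩
    change ((x i + (m i : ℝ) : ℝ) : UnitAddCircle) = (x i : UnitAddCircle)
    rw [AddCircle.coe_add, h0, add_zero]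
  have hint : Integrable fun x => e x * f x := by
    refine ((integrable_exp_neg_mul_sum_sq hc).const_mul C).mono'
      (hec.mul hf).aestronglyMeasurable (ae_of_all _ fun x => ?_)
    rw [norm_mul, he1, one_mul]
    exact hb x
  have hfin : volume (unitCube (0 : ι → ℝ)) < ⊤ := by
    refine (measure_mono (?_ : _ ⊆ Icc (0 : ι → ℝ) 1)).trans_lt isCompact_Icc.measure_lt_top
    exact fun x hx => ⟨fun i => (hx i).1.le, fun i => by simpa using (hx i).2⟩
  have hcube : ∀ x ∈ unitCube (0 : ι → ℝ), ∀ i, |x i| ≤ 1 := fun x hx i => by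
    have := hx i
    simp only [Pi.zero_apply, zero_add, mem_Ioc] at this
    rw [abs_of_pos this.1]
    exact this.2
  have hle : ∀ m : ι → ℤ, ∀ x ∈ unitCube (0 : ι → ℝ),
      ‖e x * f (x + fun i => (m i : ℝ))‖ ≤ C * (Real.exp (c * (Fintype.card ι * 1 ^ 2)) *
        Real.exp (-(c / 2 * ∑ i, (m i : ℝ) ^ 2))) := by
    intro m x hx
    rw [norm_mul, he1, one_mul]
    exact norm_add_le_of_gaussian hc hC hb (hcube x hx) m
  have hcont : ∀ m : ι → ℤ, Continuous fun x => e x * f (x + fun i => (m i : ℝ)) := by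
    intro m
    fun_prop
  have hm0 := measurableSet_unitCube (0 : ι → ℝ)
  have hIm : ∀ m : ι → ℤ, IntegrableOn (fun x => e x * f (x + fun i => (m i : ℝ)))
      (unitCube (0 : ι → ℝ)) := fun m =>
    IntegrableOn.of_bound hfin (hcont m).aestronglyMeasurable _
      ((ae_restrict_iff' hm0).mpr (ae_of_all _ (hle m)))
  have hsum : Summable fun m : ι → ℤ =>
      ∫ x in unitCube (0 : ι → ℝ), ‖e x * f (x + fun i => (m i : ℝ))‖ := by
    refine ((summable_gaussian_majorant hc C
      (Real.exp (c * (Fintype.card ι * 1 ^ 2)))).mul_left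
        (volume.real (unitCube (0 : ι → ℝ)))).of_nonneg_of_le
      (fun m => integral_nonneg fun x => norm_nonneg _) fun m => ?_
    refine (setIntegral_mono_on (hIm m).norm (integrableOn_const hfin.ne) hm0 (hle m)).trans ?_
    rw [setIntegral_const, smul_eq_mul]
  rw [UnitAddTorus.mFourierCoeff_eq_integral _ n 0]
  calc ∫ x in {x : ι → ℝ | ∀ i, x i ∈ Ioc ((0 : ι → ℝ) i) ((0 : ι → ℝ) i + 1)},
        UnitAddTorus.mFourier (-n) (fun i => (x i : UnitAddCircle)) •
          torusPeriodize f (fun i => (x i : UnitAddCircle))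
      = ∫ x in unitCube (0 : ι → ℝ), ∑' m : ι → ℤ, e x * f (x + fun i => (m i : ℝ)) := by
        refine integral_congr_ae (ae_of_all _ fun x => ?_)
        change e x * torusPeriodize f (toTorus x) = _
        rw [torusPeriodize_toTorus, periodize]
        exact tsum_mul_left.symm
    _ = ∑' m : ι → ℤ, ∫ x in unitCube (0 : ι → ℝ), e x * f (x + fun i => (m i : ℝ)) :=
        (integral_tsum_of_summable_integral_norm hIm hsum).symm
    _ = ∑' m : ι → ℤ, ∫ x in unitCube (0 : ι → ℝ),
          e (x + fun i => (m i : ℝ)) * f (x + fun i => (m i : ℝ)) := by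
        simp_rw [heper]
    _ = ∫ x, e x * f x := (integral_eq_tsum_unitCube hint).symm
    _ = fourierAt f n := by
        simp_rw [e, mFourier_neg_toTorus]
        rfl

/-- **Poisson summation** on `ℝ^ι` for continuous functions of Gaussian decay with summable Fourier
coefficients. -/
theorem tsum_eq_tsum_fourierAt (hf : Continuous f) (hc : 0 < c) (hC : 0 ≤ C)
    (hb : ∀ x, ‖f x‖ ≤ C * Real.exp (-(c * ∑ i, x i ^ 2))) (hs : Summable (fourierAt f)) :
    ∑' m : ι → ℤ, f (fun i => (m i : ℝ)) = ∑' n : ι → ℤ, fourierAt f n := by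
  let F : C(UnitAddTorus ι, ℂ) := ⟨torusPeriodize f, by
    rw [← (isOpenQuotientMap_toTorus (ι := ι)).continuous_comp_iff]
    refine (continuous_periodize hf hc hC hb).congr fun x => ?_
    exact (torusPeriodize_toTorus x).symm⟩
  have hcoeff : UnitAddTorus.mFourierCoeff F = fourierAt f :=
    funext fun n => mFourierCoeff_torusPeriodize hf hc hC hb n
  -- The Poisson formula is the Fourier series of the periodization evaluated at the origin.
  have h := UnitAddTorus.hasSum_mFourier_series_apply_of_summable (f := F)
    (hcoeff ▸ hs) (toTorus 0)
  have h0 : F (toTorus 0) = ∑' m : ι → ℤ, f (fun i => (m i : ℝ)) := by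
    refine (torusPeriodize_toTorus 0).trans ?_
    simp [periodize]
  rw [← h0, ← h.tsum_eq, hcoeff]
  refine tsum_congr fun n => ?_
  have := mFourier_neg_toTorus (-n) (0 : ι → ℝ)
  rw [neg_neg] at this
  rw [this]
  simp

end Poisson

end ArakelovZeta

namespace ArakelovZeta

open MeasureTheory Set Filter Topology NumberField NumberField.InfinitePlace Module

/-! ### Arakelov norms and Gaussian integrals on the mixed space -/

section Mixed

variable {k : Type*} [Field k] [NumberField k]

open NumberField.mixedEmbedding

open scoped Classical

/-- The quadratic form on the mixed space attached to the infinite part of an Arakelov divisor. -/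
def mixedNormSq (x : InfinitePlace k → ℝ) (z : mixedSpace k) : ℝ :=
  ∑ w : {w : InfinitePlace k // IsReal w}, z.1 w ^ 2 * Real.exp (-2 * x w) +
    ∑ w : {w : InfinitePlace k // IsComplex w}, 2 * (‖z.2 w‖ ^ 2 * Real.exp (-x w))

/-- The trace pairing on the mixed space. -/
def mixedTrace (h z : mixedSpace k) : ℝ :=
  ∑ w : {w : InfinitePlace k // IsReal w}, h.1 w * z.1 w +
    ∑ w : {w : InfinitePlace k // IsComplex w}, 2 * (h.2 w * z.2 w).re

theorem divisorNormSq_eq_mixedNormSq (D : ArakelovDivisor k) (f : k) :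
    divisorNormSq D f = mixedNormSq D.2 (mixedEmbedding k f) := by
  unfold divisorNormSq mixedNormSq
  rw [sum_eq_sum_add_sum]
  congr 1
  · refine Finset.sum_congr rfl fun w _ => ?_
    rw [if_pos w.2, mixedEmbedding_apply_isReal, ← norm_embedding_of_isReal w.2 f,
      Real.norm_eq_abs, sq_abs]
  · refine Finset.sum_congr rfl fun w _ => ?_
    rw [if_neg (not_isReal_iff_isComplex.mpr w.2), mixedEmbedding_apply_isComplex,
      norm_embedding_eq]

/-- The trace is the sum over all complex embeddings. Grouped by place, a real place contributes one
embedding and a complex place a conjugate pair, that is, twice a real part. -/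
theorem trace_eq_sum_places (f : k) :
    ((Algebra.trace ℚ k f : ℚ) : ℝ) =
      ∑ w : {w : InfinitePlace k // IsReal w}, (mixedEmbedding k f).1 w +
        ∑ w : {w : InfinitePlace k // IsComplex w}, 2 * ((mixedEmbedding k f).2 w).re := by
  have h1 : ((Algebra.trace ℚ k f : ℚ) : ℂ) = ∑ φ : k →+* ℂ, φ f := by
    have := trace_eq_sum_embeddings (K := ℚ) (L := k) ℂ (x := f)
    rw [eq_ratCast] at this
    rw [this]
    exact Fintype.sum_equiv (RingHom.equivRatAlgHom k ℂ).symm _ _ fun σ => rfl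
  have h2 : ∀ w : InfinitePlace k, ∑ φ : k →+* ℂ with InfinitePlace.mk φ = w, φ f =
      if IsReal w then embedding w f else 2 * ((embedding w f).re : ℂ) := by
    intro w
    have : (Finset.univ.filter fun φ : k →+* ℂ => InfinitePlace.mk φ = w) =
        {embedding w, ComplexEmbedding.conjugate (embedding w)} := by
      ext φ
      simp only [Finset.mem_filter, Finset.mem_univ, true_and, Finset.mem_insert,
        Finset.mem_singleton]
      conv_lhs => rw [← mk_embedding w]
      rw [mk_eq_iff, ComplexEmbedding.conjugate, star_involutive.eq_iff]
    rw [this]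
    split_ifs with hw
    · rw [conjugate_embedding_eq_of_isReal hw, Finset.pair_eq_singleton, Finset.sum_singleton]
    · rw [Finset.sum_pair]
      · rw [ComplexEmbedding.conjugate_coe_eq, Complex.add_conj]
        push_cast
        ring
      · rwa [Ne, eq_comm, ← ComplexEmbedding.isReal_iff, ← isReal_iff]
  have h3 : ((Algebra.trace ℚ k f : ℚ) : ℂ) =
      ∑ w : {w : InfinitePlace k // IsReal w}, (((mixedEmbedding k f).1 w : ℝ) : ℂ) +
        ∑ w : {w : InfinitePlace k // IsComplex w},
          ((2 * ((mixedEmbedding k f).2 w).re : ℝ) : ℂ) := by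
    rw [h1, ← Finset.univ.sum_fiberwise (fun φ => InfinitePlace.mk φ)]
    simp_rw [h2]
    rw [sum_eq_sum_add_sum]
    congr 1
    · refine Finset.sum_congr rfl fun w _ => ?_
      rw [if_pos w.2, mixedEmbedding_apply_isReal, embedding_of_isReal_apply]
    · refine Finset.sum_congr rfl fun w _ => ?_
      rw [if_neg (not_isReal_iff_isComplex.mpr w.2), mixedEmbedding_apply_isComplex]
      push_cast
      rfl
  exact_mod_cast h3

theorem trace_mul_eq_mixedTrace (f g : k) :
    ((Algebra.trace ℚ k (f * g) : ℚ) : ℝ) =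
      mixedTrace (mixedEmbedding k f) (mixedEmbedding k g) := by
  rw [trace_eq_sum_places, map_mul]
  rfl

/-- `mixedTrace h` as a linear form. -/
def mixedTraceLinear (h : mixedSpace k) : mixedSpace k →ₗ[ℝ] ℝ where
  toFun := mixedTrace h
  map_add' a b := by
    simp only [mixedTrace, Prod.fst_add, Prod.snd_add, Pi.add_apply, mul_add, Complex.add_re,
      Finset.sum_add_distrib]
    ring
  map_smul' r a := by
    simp only [mixedTrace, Prod.smul_fst, Prod.smul_snd, Pi.smul_apply, smul_eq_mul,
      RingHom.id_apply, mul_add, Finset.mul_sum]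
    congr 1
    · exact Finset.sum_congr rfl fun w _ => by ring
    · refine Finset.sum_congr rfl fun w _ => ?_
      rw [mul_smul_comm, Complex.smul_re, smul_eq_mul]
      ring

theorem continuous_mixedNormSq (x : InfinitePlace k → ℝ) : Continuous (mixedNormSq x) := by
  unfold mixedNormSq
  fun_prop

/-- Coercivity of the form, the source of the Gaussian decay. The norm is a supremum over places, so
bounding each coordinate suffices and the smallest of all the weights serves as constant. -/
theorem exists_mul_norm_sq_le_mixedNormSq (x : InfinitePlace k → ℝ) :
    ∃ c : ℝ, 0 < c ∧ ∀ z : mixedSpace k, c * ‖z‖ ^ 2 ≤ mixedNormSq x z := by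
  obtain ⟨w₀⟩ := (inferInstance : Nonempty (InfinitePlace k))
  obtain ⟨v, hv⟩ := Finite.exists_min fun w : InfinitePlace k =>
    min (Real.exp (-2 * x w)) (Real.exp (-x w))
  set c := min (Real.exp (-2 * x v)) (Real.exp (-x v)) with hc
  have hc0 : 0 < c := lt_min (Real.exp_pos _) (Real.exp_pos _)
  refine ⟨c, hc0, fun z => ?_⟩
  have hr : ∀ w : {w : InfinitePlace k // IsReal w}, c * z.1 w ^ 2 ≤ mixedNormSq x z := by
    intro w
    have h1 : c ≤ Real.exp (-2 * x w) := (hv w).trans (min_le_left _ _)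
    have h2 := Finset.single_le_sum (f := fun w : {w : InfinitePlace k // IsReal w} =>
      z.1 w ^ 2 * Real.exp (-2 * x w)) (fun _ _ => by positivity) (Finset.mem_univ w)
    have h3 : 0 ≤ ∑ w : {w : InfinitePlace k // IsComplex w},
      2 * (‖z.2 w‖ ^ 2 * Real.exp (-x w)) := Finset.sum_nonneg fun _ _ => by positivity
    unfold mixedNormSq
    nlinarith [sq_nonneg (z.1 w)]
  have hcx : ∀ w : {w : InfinitePlace k // IsComplex w}, c * ‖z.2 w‖ ^ 2 ≤ mixedNormSq x z := by
    intro w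
    have h1 : c ≤ Real.exp (-x w) := (hv w).trans (min_le_right _ _)
    have h2 := Finset.single_le_sum (f := fun w : {w : InfinitePlace k // IsComplex w} =>
      2 * (‖z.2 w‖ ^ 2 * Real.exp (-x w))) (fun _ _ => by positivity) (Finset.mem_univ w)
    have h3 : 0 ≤ ∑ w : {w : InfinitePlace k // IsReal w},
      z.1 w ^ 2 * Real.exp (-2 * x w) := Finset.sum_nonneg fun _ _ => by positivity
    have h4 : 0 ≤ ‖z.2 w‖ ^ 2 * Real.exp (-x w) := by positivity
    unfold mixedNormSq
    nlinarith [sq_nonneg ‖z.2 w‖]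
  have h0 : 0 ≤ mixedNormSq x z := by unfold mixedNormSq; positivity
  have hz : ‖z‖ ≤ √(mixedNormSq x z / c) := by
    rw [Prod.norm_def]
    refine max_le ((pi_norm_le_iff_of_nonneg (Real.sqrt_nonneg _)).mpr fun w => ?_)
      ((pi_norm_le_iff_of_nonneg (Real.sqrt_nonneg _)).mpr fun w => ?_)
    · refine Real.le_sqrt_of_sq_le ?_
      rw [le_div_iff₀ hc0, Real.norm_eq_abs, sq_abs, mul_comm]
      exact hr w
    · refine Real.le_sqrt_of_sq_le ?_
      rw [le_div_iff₀ hc0, mul_comm]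
      exact hcx w
  calc c * ‖z‖ ^ 2 ≤ c * √(mixedNormSq x z / c) ^ 2 := by gcongr
    _ = mixedNormSq x z := by
      rw [Real.sq_sqrt (by positivity)]
      field_simp

/-- Left as `-2 * -x`, the dual exponent is literally the local term of the norm for `-x`, and the
scaling constant is `exp x`. -/
theorem integral_gaussian_real (x h : ℝ) :
    ∫ t : ℝ, Complex.exp (-(2 * Real.pi * Complex.I * (h * t : ℝ)) -
      Real.pi * (t ^ 2 * Real.exp (-2 * x) : ℝ)) =
      Complex.exp (x - Real.pi * (h ^ 2 * Real.exp (-2 * -x) : ℝ)) := by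
  have hpi : (Real.pi : ℂ) ≠ 0 := by exact_mod_cast Real.pi_ne_zero
  have hx : Complex.exp x ≠ 0 := Complex.exp_ne_zero _
  have hb : 0 < ((Real.pi : ℂ) * Complex.exp (-2 * x)).re := by
    have : (Real.pi : ℂ) * Complex.exp (-2 * x) = ((Real.pi * Real.exp (-2 * x) : ℝ) : ℂ) := by
      push_cast; rfl
    rw [this, Complex.ofReal_re]
    positivity
  have := GaussianFourier.integral_cexp_neg_mul_sq_norm_add (V := ℝ) hb
    (-2 * Real.pi * Complex.I) h
  have e1 : ∀ t : ℝ, Complex.exp (-(Real.pi * Complex.exp (-2 * x)) * ‖t‖ ^ 2 +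
      -2 * Real.pi * Complex.I * (inner ℝ h t : ℝ)) =
      Complex.exp (-(2 * Real.pi * Complex.I * (h * t : ℝ)) -
        Real.pi * (t ^ 2 * Real.exp (-2 * x) : ℝ)) := by
    intro t
    have : ((‖t‖ : ℝ) : ℂ) ^ 2 = (t : ℂ) ^ 2 := by
      rw [← Complex.ofReal_pow, Real.norm_eq_abs, sq_abs, Complex.ofReal_pow]
    rw [this, real_inner_eq_re_inner, RCLike.inner_apply]
    congr 1
    simp
    ring
  simp_rw [e1] at this
  rw [this, Complex.exp_sub, Module.finrank_self]
  have e2 : (Real.pi : ℂ) / (Real.pi * Complex.exp (-2 * x)) = Complex.exp x ^ 2 := by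
    rw [← Complex.exp_nat_mul, div_mul_eq_div_div, div_self hpi, one_div, ← Complex.exp_neg]
    push_cast
    ring_nf
  have e3 : (Complex.exp x ^ 2) ^ ((1 : ℕ) / 2 : ℂ) = Complex.exp x := by
    have h1 : Complex.exp x ^ 2 = Complex.exp ((2 * x : ℝ) : ℂ) := by
      rw [← Complex.exp_nat_mul]
      push_cast
      ring_nf
    rw [h1, ← Complex.ofReal_exp, Complex.cpow_def_of_ne_zero (by
      exact_mod_cast (Real.exp_pos _).ne'), ← Complex.ofReal_log (Real.exp_pos _).le, Real.log_exp]
    push_cast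
    ring_nf
  rw [e2, e3, ← Complex.exp_sub, ← Complex.exp_add]
  congr 1
  have h2 : Complex.exp (-2 * x) * Complex.exp (-2 * -x) = 1 := by
    rw [← Complex.exp_add]
    simp
  have h3 : ((‖h‖ : ℝ) : ℂ) ^ 2 = (h : ℂ) ^ 2 := by
    rw [← Complex.ofReal_pow, Real.norm_eq_abs, sq_abs, Complex.ofReal_pow]
  have h4 : Complex.exp (-2 * x) ≠ 0 := Complex.exp_ne_zero _
  rw [h3]
  push_cast
  rw [eq_inv_of_mul_eq_one_right h2]
  field_simp
  rw [Complex.I_sq]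
  ring

/-- The factor `2⁻¹` arises because Lebesgue measure on `ℂ` is half of the self-dual measure for the
pairing `2 Re (h z)`. The conjugate of `h` appears in the proof because `Re (h z)` is the inner
product of `z` with it. -/
theorem integral_gaussian_complex (x : ℝ) (h : ℂ) :
    ∫ z : ℂ, Complex.exp (-(2 * Real.pi * Complex.I * (2 * (h * z).re : ℝ)) -
      Real.pi * (2 * (‖z‖ ^ 2 * Real.exp (-x)) : ℝ)) =
      2⁻¹ * Complex.exp (x - Real.pi * (2 * (‖h‖ ^ 2 * Real.exp (- -x)) : ℝ)) := by
  have hpi : (Real.pi : ℂ) ≠ 0 := by exact_mod_cast Real.pi_ne_zero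
  have hb : 0 < ((2 * Real.pi : ℂ) * Complex.exp (-x)).re := by
    have : (2 * Real.pi : ℂ) * Complex.exp (-x) = ((2 * Real.pi * Real.exp (-x) : ℝ) : ℂ) := by
      push_cast; rfl
    rw [this, Complex.ofReal_re]
    positivity
  have := GaussianFourier.integral_cexp_neg_mul_sq_norm_add (V := ℂ) hb
    (-4 * Real.pi * Complex.I) ((starRingEnd ℂ) h)
  have e1 : ∀ z : ℂ, Complex.exp (-(2 * Real.pi * Complex.exp (-x)) * ‖z‖ ^ 2 +
      -4 * Real.pi * Complex.I * (inner ℝ ((starRingEnd ℂ) h) z : ℝ)) =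
      Complex.exp (-(2 * Real.pi * Complex.I * (2 * (h * z).re : ℝ)) -
        Real.pi * (2 * (‖z‖ ^ 2 * Real.exp (-x)) : ℝ)) := by
    intro z
    rw [Complex.inner, Complex.conj_conj]
    congr 1
    push_cast
    ring_nf
  simp_rw [e1] at this
  rw [this, Complex.finrank_real_complex, Complex.exp_sub]
  have h2 : Complex.exp (-x) * Complex.exp x = 1 := by
    rw [← Complex.exp_add]
    simp
  have h4 : Complex.exp (-x) ≠ 0 := Complex.exp_ne_zero _
  have e2 : ((2 : ℕ) / 2 : ℂ) = 1 := by norm_num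
  rw [e2, Complex.cpow_one, Complex.norm_conj]
  have e3 : (Real.pi : ℂ) / (2 * Real.pi * Complex.exp (-x)) = 2⁻¹ * Complex.exp x := by
    rw [eq_inv_of_mul_eq_one_right h2]
    field_simp
  rw [e3, mul_assoc, ← Complex.exp_sub, ← Complex.exp_add]
  congr 2
  push_cast
  rw [neg_neg, eq_inv_of_mul_eq_one_right h2]
  field_simp
  rw [Complex.I_sq]
  ring

theorem integral_mixedSpace_gaussian (x : InfinitePlace k → ℝ) (h : mixedSpace k) :
    ∫ z : mixedSpace k, Complex.exp (-(2 * Real.pi * Complex.I * (mixedTrace h z : ℝ)) -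
      Real.pi * (mixedNormSq x z : ℝ)) =
      (2⁻¹ : ℂ) ^ nrComplexPlaces k *
        Complex.exp ((∑ w, x w : ℝ) - Real.pi * (mixedNormSq (-x) h : ℝ)) := by
  have hsplit : ∀ z : mixedSpace k,
      Complex.exp (-(2 * Real.pi * Complex.I * (mixedTrace h z : ℝ)) -
        Real.pi * (mixedNormSq x z : ℝ)) =
      (∏ w : {w : InfinitePlace k // IsReal w},
        Complex.exp (-(2 * Real.pi * Complex.I * (h.1 w * z.1 w : ℝ)) -
          Real.pi * (z.1 w ^ 2 * Real.exp (-2 * x w) : ℝ))) *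
      ∏ w : {w : InfinitePlace k // IsComplex w},
        Complex.exp (-(2 * Real.pi * Complex.I * (2 * (h.2 w * z.2 w).re : ℝ)) -
          Real.pi * (2 * (‖z.2 w‖ ^ 2 * Real.exp (-x w)) : ℝ)) := by
    intro z
    rw [← Complex.exp_sum, ← Complex.exp_sum, ← Complex.exp_add]
    congr 1
    simp only [mixedTrace, mixedNormSq, Finset.sum_sub_distrib, Finset.sum_neg_distrib,
      Finset.mul_sum, mul_add, Complex.ofReal_add, Complex.ofReal_sum]
    ring_nf
  simp_rw [hsplit]
  rw [Measure.volume_eq_prod, integral_prod_mul (fun a : {w : InfinitePlace k // IsReal w} → ℝ =>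
      ∏ w : {w : InfinitePlace k // IsReal w},
        Complex.exp (-(2 * Real.pi * Complex.I * (h.1 w * a w : ℝ)) -
          Real.pi * (a w ^ 2 * Real.exp (-2 * x w) : ℝ)))
      (fun a : {w : InfinitePlace k // IsComplex w} → ℂ =>
      ∏ w : {w : InfinitePlace k // IsComplex w},
        Complex.exp (-(2 * Real.pi * Complex.I * (2 * (h.2 w * a w).re : ℝ)) -
          Real.pi * (2 * (‖a w‖ ^ 2 * Real.exp (-x w)) : ℝ))),
    integral_fintype_prod_volume_eq_prod
      (fun (w : {w : InfinitePlace k // IsReal w}) (t : ℝ) =>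
        Complex.exp (-(2 * Real.pi * Complex.I * (h.1 w * t : ℝ)) -
          Real.pi * (t ^ 2 * Real.exp (-2 * x w) : ℝ))),
    integral_fintype_prod_volume_eq_prod
      (fun (w : {w : InfinitePlace k // IsComplex w}) (t : ℂ) =>
        Complex.exp (-(2 * Real.pi * Complex.I * (2 * (h.2 w * t).re : ℝ)) -
          Real.pi * (2 * (‖t‖ ^ 2 * Real.exp (-x w)) : ℝ)))]
  simp_rw [integral_gaussian_real, integral_gaussian_complex]
  rw [Finset.prod_mul_distrib, Finset.prod_const, Finset.card_univ, mul_left_comm]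
  congr 1
  rw [← Complex.exp_sum, ← Complex.exp_sum, ← Complex.exp_add, sum_eq_sum_add_sum]
  congr 1
  simp only [mixedNormSq, Finset.sum_sub_distrib, Finset.mul_sum, mul_add, Complex.ofReal_add,
    Complex.ofReal_sum, Pi.neg_apply]
  ring_nf

end Mixed

end ArakelovZeta

namespace ArakelovZeta

open MeasureTheory Set Filter Topology NumberField NumberField.InfinitePlace Module

/-! ### The Riemann-Roch theorem -/

/-- Both sides integrate against Haar measures, and the scalar between them is read off from the
fundamental domain, the image of the unit cube. -/
theorem integral_comp_equivFun_symm {E ι : Type*} [NormedAddCommGroup E] [NormedSpace ℝ E]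
    [FiniteDimensional ℝ E] [MeasureSpace E] [BorelSpace E] [(volume : Measure E).IsAddHaarMeasure]
    [Fintype ι] (B : Basis ι ℝ E) (F : E → ℂ) :
    volume.real (ZSpan.fundamentalDomain B) • ∫ t : ι → ℝ, F (B.equivFun.symm t) = ∫ z, F z := by
  have : SecondCountableTopology E := by
    have := FiniteDimensional.proper_real E
    infer_instance
  let ν : Measure E := Measure.map B.equivFunL.symm (volume : Measure (ι → ℝ))
  have hν : ν.IsAddHaarMeasure := B.equivFunL.symm.isAddHaarMeasure_map _
  set c := (volume : Measure E).addHaarScalarFactor ν with hc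
  have h : (volume : Measure E) = c • ν := Measure.isAddLeftInvariant_eq_smul _ _
  have hFD : ν (ZSpan.fundamentalDomain B) = 1 := by
    have e : B.equivFunL.symm ⁻¹' ZSpan.fundamentalDomain B = univ.pi fun _ => Ico (0 : ℝ) 1 := by
      ext t
      have h1 : ∀ i, B.repr (B.equivFunL.symm t) i = t i := fun i =>
        congrFun (B.equivFun.apply_symm_apply t) i
      simp [ZSpan.mem_fundamentalDomain, h1]
    rw [Measure.map_apply B.equivFunL.symm.continuous.measurable
      (ZSpan.fundamentalDomain_measurableSet B), e, Real.volume_pi_Ico]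
    simp
  have hvol : volume.real (ZSpan.fundamentalDomain B) = c := by
    rw [measureReal_def, h, Measure.smul_apply, hFD]
    simp
  rw [hvol]
  conv_rhs => rw [h, integral_smul_nnreal_measure]
  congr 1
  exact (integral_map_equiv B.equivFunL.symm.toHomeomorph.toMeasurableEquiv F).symm

section

variable {k : Type*} [Field k] [NumberField k] {ι : Type*} [Fintype ι]

open NumberField.mixedEmbedding

open scoped Classical

theorem exists_mul_sum_sq_le_mixedNormSq (x : InfinitePlace k → ℝ) (B : Basis ι ℝ (mixedSpace k)) :
    ∃ c : ℝ, 0 < c ∧ ∀ t : ι → ℝ, c * ∑ i, t i ^ 2 ≤ mixedNormSq x (B.equivFun.symm t) := by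
  obtain ⟨c, hc, h⟩ := exists_mul_norm_sq_le_mixedNormSq x
  set N := ‖(B.equivFunL : mixedSpace k →L[ℝ] ι → ℝ)‖ with hN
  set M : ℝ := Fintype.card ι * N ^ 2 + 1 with hM
  have hM0 : 0 < M := by positivity
  refine ⟨c / M, by positivity, fun t => ?_⟩
  set z := B.equivFun.symm t with hz
  have h1 : ‖t‖ ≤ N * ‖z‖ := by
    have := (B.equivFunL : mixedSpace k →L[ℝ] ι → ℝ).le_opNorm z
    have e : (B.equivFunL : mixedSpace k →L[ℝ] ι → ℝ) z = t := B.equivFun.apply_symm_apply t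
    rwa [e] at this
  have h2 : ∑ i, t i ^ 2 ≤ M * ‖z‖ ^ 2 := by
    calc ∑ i, t i ^ 2 ≤ ∑ _i : ι, (N * ‖z‖) ^ 2 := by
          refine Finset.sum_le_sum fun i _ => ?_
          rw [← sq_abs]
          exact pow_le_pow_left₀ (abs_nonneg _) ((norm_le_pi_norm t i).trans h1) 2
      _ = Fintype.card ι * N ^ 2 * ‖z‖ ^ 2 := by
          rw [Finset.sum_const, nsmul_eq_mul, Finset.card_univ]
          ring
      _ ≤ M * ‖z‖ ^ 2 := by
          rw [hM]
          nlinarith [sq_nonneg ‖z‖]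
  calc c / M * ∑ i, t i ^ 2 ≤ c / M * (M * ‖z‖ ^ 2) := by gcongr
    _ = c * ‖z‖ ^ 2 := by field_simp
    _ ≤ _ := h z

/-- The `ℤ`-coordinates of a fractional ideal with respect to a `ℤ`-basis. -/
def latticeEquiv {J : FractionalIdeal (𝓞 k)⁰ k} (b : Basis ι ℚ k)
    (h : ∀ f, f ∈ Submodule.span ℤ (range b) ↔ f ∈ J) : (ι → ℤ) ≃ {f : k // f ∈ J} :=
  (b.restrictScalars ℤ).equivFun.symm.toEquiv.trans (Equiv.subtypeEquivRight h)

theorem coe_latticeEquiv {J : FractionalIdeal (𝓞 k)⁰ k} (b : Basis ι ℚ k)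
    (h : ∀ f, f ∈ Submodule.span ℤ (range b) ↔ f ∈ J) (m : ι → ℤ) :
    (latticeEquiv b h m : k) = ∑ i, m i • b i := by
  change (((b.restrictScalars ℤ).equivFun.symm m : Submodule.span ℤ (range b)) : k) = _
  rw [Basis.equivFun_symm_apply, Submodule.coe_sum]
  refine Finset.sum_congr rfl fun i _ => ?_
  rw [Submodule.coe_smul, Basis.restrictScalars_apply]

theorem mixedEmbedding_sum_smul {b : Basis ι ℚ k} {B : Basis ι ℝ (mixedSpace k)}
    (hB : ∀ i, B i = mixedEmbedding k (b i)) (m : ι → ℤ) :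
    mixedEmbedding k (∑ i, m i • b i) = B.equivFun.symm fun i => (m i : ℝ) := by
  simp [Basis.equivFun_symm_apply, map_sum, hB]
  rfl

variable (x : InfinitePlace k → ℝ) (B : Basis ι ℝ (mixedSpace k))

/-- The Gaussian of an Arakelov norm, in coordinates. -/
def coordGaussian (t : ι → ℝ) : ℂ := Complex.exp (-(Real.pi * (mixedNormSq x (B.equivFun.symm t) : ℝ)))

theorem continuous_coordGaussian : Continuous (coordGaussian x B) := by
  have h1 : Continuous fun t : ι → ℝ => B.equivFun.symm t := B.equivFunL.symm.continuous
  have h2 := (continuous_mixedNormSq x).comp h1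
  unfold coordGaussian
  fun_prop

theorem norm_coordGaussian (t : ι → ℝ) :
    ‖coordGaussian x B t‖ = Real.exp (-(Real.pi * mixedNormSq x (B.equivFun.symm t))) := by
  rw [coordGaussian, ← Complex.ofReal_mul, ← Complex.ofReal_neg, ← Complex.ofReal_exp,
    Complex.norm_real, Real.norm_of_nonneg (Real.exp_pos _).le]

theorem exists_norm_coordGaussian_le :
    ∃ c : ℝ, 0 < c ∧ ∀ t, ‖coordGaussian x B t‖ ≤ 1 * Real.exp (-(c * ∑ i, t i ^ 2)) := by
  obtain ⟨c, hc, h⟩ := exists_mul_sum_sq_le_mixedNormSq x B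
  refine ⟨Real.pi * c, by positivity, fun t => ?_⟩
  rw [norm_coordGaussian, one_mul, mul_assoc]
  exact Real.exp_le_exp.mpr (neg_le_neg (mul_le_mul_of_nonneg_left (h t) Real.pi_pos.le))

theorem summable_coordGaussian : Summable fun m : ι → ℤ => coordGaussian x B fun i => (m i : ℝ) := by
  obtain ⟨c, hc, h⟩ := exists_norm_coordGaussian_le x B
  exact .of_norm_bounded ((summable_exp_neg_mul_sum_sq hc).mul_left 1) fun m => h _

variable {x B}

/-- Integral frequencies are the elements of the lattice spanned by the trace-dual basis, since that
basis pairs with `b` to the identity matrix. -/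
theorem sum_mul_eq_mixedTrace {b : Basis ι ℚ k} (hB : ∀ i, B i = mixedEmbedding k (b i))
    (n : ι → ℤ) (t : ι → ℝ) :
    ∑ i, (n i : ℝ) * t i =
      mixedTrace (mixedEmbedding k (∑ i, n i • b.traceDual i)) (B.equivFun.symm t) := by
  rw [Basis.equivFun_symm_apply]
  change _ = mixedTraceLinear _ _
  rw [map_sum]
  refine Finset.sum_congr rfl fun j _ => ?_
  rw [map_smul, smul_eq_mul, mul_comm]
  congr 1
  change _ = mixedTrace _ _
  rw [hB, ← trace_mul_eq_mixedTrace, Finset.sum_mul, map_sum]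
  have : ∀ i, Algebra.trace ℚ k (n i • b.traceDual i * b j) = if j = i then (n i : ℚ) else 0 := by
    intro i
    rw [smul_mul_assoc, map_zsmul, Basis.trace_traceDual_mul]
    split_ifs <;> simp
  simp_rw [this]
  simp

theorem fourierAt_coordGaussian {b : Basis ι ℚ k} (hB : ∀ i, B i = mixedEmbedding k (b i))
    (n : ι → ℤ) :
    volume.real (ZSpan.fundamentalDomain B) * fourierAt (coordGaussian x B) n =
      (2⁻¹ : ℂ) ^ nrComplexPlaces k * Complex.exp (∑ w, x w : ℝ) *
        Complex.exp (-(Real.pi *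
          (mixedNormSq (-x) (mixedEmbedding k (∑ i, n i • b.traceDual i)) : ℝ))) := by
  set h := mixedEmbedding k (∑ i, n i • b.traceDual i) with hh
  have key := integral_comp_equivFun_symm B fun z => Complex.exp
    (-(2 * Real.pi * Complex.I * (mixedTrace h z : ℝ)) - Real.pi * (mixedNormSq x z : ℝ))
  rw [integral_mixedSpace_gaussian, sub_eq_add_neg, Complex.exp_add, ← mul_assoc] at key
  rw [← key, Complex.real_smul, fourierAt]
  congr 2
  ext t
  rw [coordGaussian, ← Complex.exp_add, ← sum_mul_eq_mixedTrace hB]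
  push_cast
  ring_nf

end

/-! ### Theta series as lattice sums, dual ideals and the degree -/

section RiemannRoch

variable {k : Type*} [Field k] [NumberField k]

open NumberField.mixedEmbedding

open scoped Classical

theorem theta_eq_tsum_coordGaussian {ι : Type*} [Fintype ι] (D : ArakelovDivisor k)
    {b : Basis ι ℚ k} {B : Basis ι ℝ (mixedSpace k)} (hB : ∀ i, B i = mixedEmbedding k (b i))
    (hb : ∀ f, f ∈ Submodule.span ℤ (range b) ↔ f ∈ divisorIdeal D) :
    (theta D : ℂ) = ∑' m : ι → ℤ, coordGaussian D.2 B fun i => (m i : ℝ) := by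
  rw [theta, Complex.ofReal_tsum, ← (latticeEquiv b hb).tsum_eq]
  refine tsum_congr fun m => ?_
  rw [coe_latticeEquiv, divisorNormSq_eq_mixedNormSq, mixedEmbedding_sum_smul hB, coordGaussian]
  push_cast
  rfl

/-- The ideal of a divisor as a unit of the monoid of fractional ideals. -/
def divisorIdealUnit (D : ArakelovDivisor k) : (FractionalIdeal (𝓞 k)⁰ k)ˣ :=
  Units.mk0 (divisorIdeal D) (divisorIdeal_ne_zero D)

theorem mem_span_basisOfFractionalIdeal_divisorIdealUnit (D : ArakelovDivisor k) (f : k) :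
    f ∈ Submodule.span ℤ (range (basisOfFractionalIdeal k (divisorIdealUnit D))) ↔
      f ∈ divisorIdeal D :=
  mem_span_basisOfFractionalIdeal k

theorem summable_theta (D : ArakelovDivisor k) :
    Summable fun f : divisorIdeal D => Real.exp (-(Real.pi * divisorNormSq D (f : k))) := by
  have hB := fractionalIdealLatticeBasis_apply k (divisorIdealUnit D)
  have hb := mem_span_basisOfFractionalIdeal_divisorIdealUnit D
  rw [← (latticeEquiv _ hb).summable_iff]
  refine (summable_coordGaussian D.2
    (fractionalIdealLatticeBasis k (divisorIdealUnit D))).norm.congr fun m => ?_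
  rw [norm_coordGaussian, Function.comp_apply, coe_latticeEquiv, divisorNormSq_eq_mixedNormSq,
    mixedEmbedding_sum_smul hB]

theorem divisorNormSq_nonneg (D : ArakelovDivisor k) (f : k) : 0 ≤ divisorNormSq D f :=
  Finset.sum_nonneg fun v _ => by split_ifs <;> positivity

theorem one_le_theta (D : ArakelovDivisor k) : 1 ≤ theta D := by
  refine le_of_eq_of_le ?_ ((summable_theta D).le_tsum
    ⟨0, (divisorIdeal D : Submodule (𝓞 k) k).zero_mem⟩ fun f _ => (Real.exp_pos _).le)
  have : divisorNormSq D 0 = 0 := Finset.sum_eq_zero fun v _ => by split_ifs <;> simp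
  simp [this]

theorem divisorIdeal_ordDivisor {J : FractionalIdeal (𝓞 k)⁰ k} (hJ : J ≠ 0)
    (x : InfinitePlace k → ℝ) : divisorIdeal (ordDivisor J, x) = J⁻¹ := by
  conv_rhs => rw [← FractionalIdeal.finprod_heightOneSpectrum_factorization' k hJ]
  rw [finprod_eq_prod_of_mulSupport_subset (s := (ordDivisor J).support)]
  · simp [divisorIdeal, Finsupp.prod]
  · intro p hp
    simp only [Function.mem_mulSupport] at hp
    simp only [Finset.mem_coe, Finsupp.mem_support_iff, ordDivisor_apply]
    exact fun h => hp (by rw [h, zpow_zero])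

theorem divisorIdeal_zero : divisorIdeal (0 : ArakelovDivisor k) = 1 := by
  simp [divisorIdeal]

theorem divisorIdeal_neg (D : ArakelovDivisor k) : divisorIdeal (-D) = (divisorIdeal D)⁻¹ := by
  refine eq_inv_of_mul_eq_one_left ?_
  rw [← divisorIdeal_add, neg_add_cancel, divisorIdeal_zero]

theorem divisorIdeal_canonicalDivisor :
    divisorIdeal (canonicalDivisor k) = FractionalIdeal.dual ℤ ℚ 1 := by
  rw [canonicalDivisor, divisorIdeal_ordDivisor, coeIdeal_differentIdeal ℤ ℚ k (𝓞 k), inv_inv]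
  rw [FractionalIdeal.coeIdeal_ne_zero]
  exact differentIdeal_ne_bot

theorem divisorIdeal_canonicalDivisor_sub (D : ArakelovDivisor k) :
    divisorIdeal (canonicalDivisor k - D) = FractionalIdeal.dual ℤ ℚ (divisorIdeal D) := by
  rw [sub_eq_add_neg, divisorIdeal_add, divisorIdeal_neg, divisorIdeal_canonicalDivisor,
    ← FractionalIdeal.dual_eq_mul_inv]

/-- The dual of a fractional ideal `I` is `𝔡⁻¹ I⁻¹`, which for `I = I(D)` is `I(κ - D)`; hence the
frequency side of Poisson summation is again a theta series. -/
theorem mem_span_traceDual {ι : Type*} [Fintype ι] (D : ArakelovDivisor k) {b : Basis ι ℚ k}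
    (hb : ∀ f, f ∈ Submodule.span ℤ (range b) ↔ f ∈ divisorIdeal D) (f : k) :
    f ∈ Submodule.span ℤ (range b.traceDual) ↔ f ∈ divisorIdeal (canonicalDivisor k - D) := by
  have h : (divisorIdeal D : Submodule (𝓞 k) k).restrictScalars ℤ =
      Submodule.span ℤ (range b) := by
    ext f
    rw [hb]
    rfl
  rw [← Submodule.traceDual_span_of_basis ℤ _ b h, divisorIdeal_canonicalDivisor_sub,
    ← FractionalIdeal.coe_dual ℤ ℚ (divisorIdeal_ne_zero D)]
  rfl

theorem norm_divisorIdeal_pos (D : ArakelovDivisor k) :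
    0 < ((FractionalIdeal.absNorm (divisorIdeal D) : ℚ) : ℝ) := by
  refine Rat.cast_pos.mpr (lt_of_le_of_ne (FractionalIdeal.absNorm_nonneg _) (Ne.symm ?_))
  exact FractionalIdeal.absNorm_eq_zero_iff.not.mpr (divisorIdeal_ne_zero D)

variable (k) in
/-- The degree of an Arakelov divisor. -/
def degree : ArakelovDivisor k →+ ℝ where
  toFun D := ∑ v, D.2 v - Real.log (FractionalIdeal.absNorm (divisorIdeal D) : ℚ)
  map_zero' := by
    rw [divisorIdeal_zero, FractionalIdeal.absNorm_one]
    simp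
  map_add' D E := by
    rw [divisorIdeal_add, map_mul, Rat.cast_mul, Real.log_mul (norm_divisorIdeal_pos D).ne'
      (norm_divisorIdeal_pos E).ne']
    simp only [Prod.snd_add, Pi.add_apply, Finset.sum_add_distrib]
    ring

/-- This is the product formula. -/
theorem degree_principal (f : Additive kˣ) : degree k (principal k f) = 0 := by
  have hf : ((Additive.toMul f : kˣ) : k) ≠ 0 := Units.ne_zero _
  have h := prod_eq_abs_norm ((Additive.toMul f : kˣ) : k)
  change ∑ v, (principal k f).2 v - Real.log (FractionalIdeal.absNorm _ : ℚ) = 0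
  rw [divisorIdeal_principal, map_inv₀, FractionalIdeal.absNorm_span_singleton, Rat.cast_inv,
    Real.log_inv, ← h, Real.log_prod]
  · simp only [principal, AddMonoidHom.coe_mk, ZeroHom.coe_mk, Real.log_pow,
      Finset.sum_neg_distrib]
    ring
  · intro v _
    exact pow_ne_zero _ (by simp)

theorem degree_canonicalDivisor : degree k (canonicalDivisor k) = Real.log (discr k).natAbs := by
  change ∑ v, (canonicalDivisor k).2 v - Real.log (FractionalIdeal.absNorm _ : ℚ) = _
  rw [divisorIdeal_canonicalDivisor, ← inv_inv (FractionalIdeal.dual ℤ ℚ 1),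
    ← coeIdeal_differentIdeal ℤ ℚ k (𝓞 k), map_inv₀, FractionalIdeal.coeIdeal_absNorm,
    absNorm_differentIdeal k]
  simp [canonicalDivisor]

/-- The **Riemann-Roch theorem** of van der Geer and Schoof. -/
theorem theta_eq_theta_canonicalDivisor_sub (D : ArakelovDivisor k) :
    theta D = theta (canonicalDivisor k - D) *
      Real.exp (degree k D - Real.log (discr k).natAbs / 2) := by
  set I := divisorIdealUnit D with hI
  set b := basisOfFractionalIdeal k I with hbdef
  set B := fractionalIdealLatticeBasis k I with hBdef
  have hB : ∀ i, B i = mixedEmbedding k (b i) := fractionalIdealLatticeBasis_apply k I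
  have hb := mem_span_basisOfFractionalIdeal_divisorIdealUnit D
  obtain ⟨c, hc, hbound⟩ := exists_norm_coordGaussian_le D.2 B
  set v : ℝ := volume.real (ZSpan.fundamentalDomain B) with hv
  set N : ℝ := ((FractionalIdeal.absNorm (divisorIdeal D) : ℚ) : ℝ) with hN
  have hN0 : 0 < N := norm_divisorIdeal_pos D
  have hd0 : (0 : ℝ) < (discr k).natAbs := by
    exact_mod_cast Nat.pos_of_ne_zero (Int.natAbs_ne_zero.mpr (discr_ne_zero k))
  have hvol : v = N * 2⁻¹ ^ nrComplexPlaces k * √((discr k).natAbs : ℝ) := by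
    have h1 := ZLattice.covolume_eq_measure_fundamentalDomain _ volume
      (fundamentalDomain_idealLattice k I)
    rw [hv, ← h1, covolume_idealLattice, Nat.cast_natAbs, Int.cast_abs]
    rfl
  have hv0 : v ≠ 0 := by rw [hvol]; positivity
  set A : ℝ := Real.exp (degree k D - Real.log (discr k).natAbs / 2) with hA
  -- The power of `2⁻¹` in the covolume cancels the one from the complex Gaussian integrals, so the
  -- ratio is `exp (∑ x) / (N √d)`, the exponential of the shifted degree.
  have hA' : v * A = 2⁻¹ ^ nrComplexPlaces k * Real.exp (∑ w, D.2 w) := by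
    have h1 : degree k D = ∑ w, D.2 w - Real.log N := rfl
    rw [hA, h1, hvol, Real.exp_sub, Real.exp_sub, Real.exp_log hN0,
      ← Real.log_sqrt hd0.le, Real.exp_log (Real.sqrt_pos.mpr hd0)]
    have := (Real.sqrt_pos.mpr hd0).ne'
    field_simp
  have hF : ∀ n, fourierAt (coordGaussian D.2 B) n = A * Complex.exp (-(Real.pi *
      (divisorNormSq (canonicalDivisor k - D) (∑ i, n i • b.traceDual i) : ℝ))) := by
    intro n
    have h1 := fourierAt_coordGaussian (x := D.2) hB n
    have h2 : (2⁻¹ : ℂ) ^ nrComplexPlaces k * Complex.exp (∑ w, D.2 w : ℝ) = v * A := by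
      have := congrArg (fun r : ℝ => (r : ℂ)) hA'.symm
      push_cast at this ⊢
      exact this
    have h3 : (canonicalDivisor k - D).2 = -D.2 := by simp [canonicalDivisor]
    rw [h2, mul_assoc] at h1
    rw [mul_left_cancel₀ (by exact_mod_cast hv0) h1, divisorNormSq_eq_mixedNormSq, h3]
  have hb' := mem_span_traceDual D hb
  have hs : Summable fun n : Free.ChooseBasisIndex ℤ I → ℤ => Complex.exp (-(Real.pi *
      (divisorNormSq (canonicalDivisor k - D) (∑ i, n i • b.traceDual i) : ℝ))) := by
    have := (latticeEquiv _ hb').summable_iff.mpr (summable_theta (canonicalDivisor k - D))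
    refine (Complex.ofRealCLM.summable this).congr fun n => ?_
    rw [Function.comp_apply, coe_latticeEquiv, Complex.ofRealCLM_apply]
    push_cast
    rfl
  have hP := tsum_eq_tsum_fourierAt (continuous_coordGaussian D.2 B) hc zero_le_one hbound
    ((hs.mul_left (A : ℂ)).congr fun n => (hF n).symm)
  rw [← theta_eq_tsum_coordGaussian D hB hb] at hP
  simp_rw [hF] at hP
  rw [tsum_mul_left] at hP
  have ht : (theta (canonicalDivisor k - D) : ℂ) = ∑' n : Free.ChooseBasisIndex ℤ I → ℤ, Complex.exp (-(Real.pi *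
      (divisorNormSq (canonicalDivisor k - D) (∑ i, n i • b.traceDual i) : ℝ))) := by
    rw [theta, Complex.ofReal_tsum, ← (latticeEquiv _ hb').tsum_eq]
    refine tsum_congr fun n => ?_
    rw [coe_latticeEquiv]
    push_cast
    rfl
  rw [← ht] at hP
  have : theta D = A * theta (canonicalDivisor k - D) := by exact_mod_cast hP
  rw [this, mul_comm]

end RiemannRoch

end ArakelovZeta

namespace ArakelovZeta

open MeasureTheory Set Filter Topology NumberField NumberField.InfinitePlace Module
open NumberField.Units NumberField.Units.dirichletUnitTheorem

/-! ### A set of representatives of the Arakelov divisor classes -/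

section

variable {k : Type*} [Field k] [NumberField k]

open scoped Classical

theorem ordDivisor_divisorIdeal (D : ArakelovDivisor k) : ordDivisor (divisorIdeal D) = -D.1 := by
  ext p
  have h : (divisorIdeal D)⁻¹ =
      D.1.prod fun (q : IsDedekindDomain.HeightOneSpectrum (𝓞 k)) n =>
        (q.asIdeal : FractionalIdeal (𝓞 k)⁰ k) ^ n := by
    rw [divisorIdeal, Finsupp.prod, ← Finset.prod_inv_distrib, Finsupp.prod]
    exact Finset.prod_congr rfl fun q _ => by rw [zpow_neg, inv_inv]
  have h2 := FractionalIdeal.count_finsuppProd k p D.1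
  rw [← h, FractionalIdeal.count_inv] at h2
  simpa using (neg_eq_iff_eq_neg.mp h2)

variable (k) in
/-- The finite parts of the principal divisors. -/
def finPrincipal : AddSubgroup (FinDivisor k) :=
  (principal k).range.map (AddMonoidHom.fst _ _)

theorem mem_finPrincipal {ν : FinDivisor k} :
    ν ∈ finPrincipal k ↔ ∃ f, (principal k f).1 = ν := by
  simp [finPrincipal, AddSubgroup.mem_map]

/-- Sending a finite divisor to the class of its ideal embeds the quotient into the class group. -/
instance finite_quotient_finPrincipal : Finite (FinDivisor k ⧸ finPrincipal k) := by
  let c : FinDivisor k → ClassGroup (𝓞 k) := fun ν =>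
    (ClassGroup.equiv k).symm (QuotientGroup.mk (divisorIdealUnit (ν, 0)))
  refine Finite.of_injective (fun q => c q.out) fun q q' h => ?_
  have h1 := QuotientGroup.eq.mp ((ClassGroup.equiv k).symm.injective h)
  obtain ⟨f, hf⟩ := h1
  rw [← QuotientAddGroup.out_eq' q, ← QuotientAddGroup.out_eq' q', QuotientAddGroup.eq,
    mem_finPrincipal]
  -- The sign reflects `I(div f) = (f)⁻¹`.
  refine ⟨-(Additive.ofMul f), ?_⟩
  have h2 := (toPrincipalIdeal_eq_iff (K := k)).mp hf
  have h3 : (((divisorIdealUnit (q.out, 0))⁻¹ * divisorIdealUnit (q'.out, 0) :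
      (FractionalIdeal (𝓞 k)⁰ k)ˣ) : FractionalIdeal (𝓞 k)⁰ k)
      = divisorIdeal ((-q.out + q'.out, 0) : ArakelovDivisor k) := by
    have e : ((-q.out + q'.out, 0) : ArakelovDivisor k) = -(q.out, 0) + (q'.out, 0) := by
      simp
    rw [e, divisorIdeal_add, divisorIdeal_neg]
    simp [divisorIdealUnit]
  rw [h3] at h2
  have h4 := ordDivisor_divisorIdeal ((-q.out + q'.out, 0) : ArakelovDivisor k)
  rw [← h2] at h4
  have h5 : (principal k (Additive.ofMul f)).1 = -(-q.out + q'.out) := h4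
  rw [map_neg, Prod.fst_neg, h5, neg_neg]

variable (k) in
/-- A finite set of representatives of the finite divisors modulo principal ones. -/
def finReps : Set (FinDivisor k) := range (Quotient.out : FinDivisor k ⧸ finPrincipal k → _)

theorem finite_finReps : (finReps k).Finite :=
  have : Finite (Quotient (QuotientAddGroup.leftRel (finPrincipal k))) :=
    finite_quotient_finPrincipal
  finite_range _

theorem exists_add_principal_mem_finReps (ν : FinDivisor k) :
    ∃ f, ν + (principal k f).1 ∈ finReps k := by
  have h : -ν + (QuotientAddGroup.mk ν : FinDivisor k ⧸ finPrincipal k).out ∈ finPrincipal k :=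
    QuotientAddGroup.eq.mp (QuotientAddGroup.out_eq' _).symm
  obtain ⟨f, hf⟩ := mem_finPrincipal.mp h
  exact ⟨f, _, by rw [hf, add_neg_cancel_left]⟩

theorem principal_fst_eq_zero_of_mem_finReps {ν : FinDivisor k} {f : Additive kˣ}
    (h : ν ∈ finReps k) (h' : ν + (principal k f).1 ∈ finReps k) : (principal k f).1 = 0 := by
  obtain ⟨q, hq⟩ := h
  obtain ⟨q', hq'⟩ := h'
  have : q = q' := by
    rw [← QuotientAddGroup.out_eq' q, ← QuotientAddGroup.out_eq' q', QuotientAddGroup.eq, hq', hq,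
      neg_add_cancel_left]
    exact mem_finPrincipal.mpr ⟨f, rfl⟩
  rw [← this, hq] at hq'
  simpa using hq'

variable (k) in
/-- A unit of the ring of integers, as an element of the additive form of `kˣ`. -/
def unitToField (u : (𝓞 k)ˣ) : Additive kˣ := Additive.ofMul (Units.map (algebraMap (𝓞 k) k) u)

/-- Both `f` and its inverse have trivial finite divisor, so both are integral. -/
theorem exists_unit_of_principal_fst_eq_zero {f : Additive kˣ} (h : (principal k f).1 = 0) :
    ∃ u : (𝓞 k)ˣ, unitToField k u = f := by
  have h1 : ∀ g : Additive kˣ, (principal k g).1 = 0 →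
      ∃ a : 𝓞 k, algebraMap (𝓞 k) k a = ((Additive.toMul g : kˣ) : k) := by
    intro g hg
    have e : divisorIdeal (principal k g) = 1 := by
      simp [divisorIdeal, hg]
    rw [divisorIdeal_principal, inv_eq_one] at e
    rw [← FractionalIdeal.mem_one_iff (S := (𝓞 k)⁰), ← e]
    exact FractionalIdeal.mem_spanSingleton_self _ _
  obtain ⟨a, ha⟩ := h1 f h
  obtain ⟨b, hb⟩ := h1 (-f) (by rw [map_neg, Prod.fst_neg, h, neg_zero])
  have hab : a * b = 1 := by
    apply FaithfulSMul.algebraMap_injective (𝓞 k) k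
    rw [map_mul, ha, hb, map_one]
    simp
  refine ⟨⟨a, b, hab, by rw [mul_comm, hab]⟩, ?_⟩
  apply Additive.toMul.injective
  ext1
  exact ha

theorem principal_unitToField_fst (u : (𝓞 k)ˣ) : (principal k (unitToField k u)).1 = 0 := by
  have h : ∀ v : (𝓞 k)ˣ, (algebraMap (𝓞 k) k v) ∈ (1 : FractionalIdeal (𝓞 k)⁰ k) := fun v =>
    FractionalIdeal.coe_mem_one _ _
  have h1 : FractionalIdeal.spanSingleton (𝓞 k)⁰ (algebraMap (𝓞 k) k u) = 1 := by
    refine le_antisymm (FractionalIdeal.spanSingleton_le_iff_mem.mpr (h u)) ?_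
    rw [← FractionalIdeal.spanSingleton_one, FractionalIdeal.spanSingleton_le_iff_mem,
      FractionalIdeal.mem_spanSingleton]
    refine ⟨((u⁻¹ : (𝓞 k)ˣ) : 𝓞 k), ?_⟩
    rw [Algebra.smul_def, ← map_mul, Units.inv_mul, map_one]
  ext p
  change FractionalIdeal.count k p (FractionalIdeal.spanSingleton (𝓞 k)⁰ (algebraMap (𝓞 k) k u)) = 0
  rw [h1, FractionalIdeal.count_one]

variable (k) in
/-- The normalized local degrees `e_v / [k : ℚ]`. -/
def weight (v : InfinitePlace k) : ℝ := mult v / finrank ℚ k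

theorem sum_weight : ∑ v, weight k v = 1 := by
  have h : (finrank ℚ k : ℝ) ≠ 0 := by
    exact_mod_cast (finrank_pos (R := ℚ) (M := k)).ne'
  simp only [weight]
  rw [← Finset.sum_div, ← Nat.cast_sum, sum_mult_eq, div_self h]

variable (k) in
/-- The projection of the infinite part of a divisor to the degree zero space, in coordinates. -/
def logProj : (InfinitePlace k → ℝ) →ₗ[ℝ] logSpace k where
  toFun x w := x w - weight k w * ∑ v, x v
  map_add' x y := by
    ext w
    simp only [Pi.add_apply, Finset.sum_add_distrib]
    ring
  map_smul' c x := by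
    ext w
    simp only [Pi.smul_apply, smul_eq_mul, RingHom.id_apply, ← Finset.mul_sum]
    ring

theorem logProj_apply (x : InfinitePlace k → ℝ) (w : {w : InfinitePlace k // w ≠ w₀}) :
    logProj k x w = x w - weight k w * ∑ v, x v := rfl

/-- Translation along `weight` moves the degree and leaves the degree-zero part fixed, so
`divisorReps` is invariant under it. -/
theorem logProj_weight : logProj k (weight k) = 0 := by
  ext w
  rw [logProj_apply, sum_weight]
  simp

/-- The coefficients of the divisor of a unit sum to zero, so the correction term in `logProj`
vanishes; units thus act by translations by the unit lattice. -/
theorem logProj_principal_unitToField (u : (𝓞 k)ˣ) :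
    logProj k (principal k (unitToField k u)).2 = -logEmbedding k (Additive.ofMul u) := by
  have h : ∀ v, (principal k (unitToField k u)).2 v = -(mult v * Real.log (v (u : k))) :=
    fun v => rfl
  ext w
  rw [logProj_apply]
  simp only [h, Finset.sum_neg_distrib, sum_mult_mul_log, Pi.neg_apply, logEmbedding_component]
  simp

variable (k) in
/-- The basis of the logarithmic space given by fundamental units. -/
def logBasis : Basis (Fin (rank k)) ℝ (logSpace k) :=
  (basisUnitLattice k).ofZLatticeBasis ℝ (unitLattice k)

theorem mem_span_logBasis {z : logSpace k} :
    z ∈ Submodule.span ℤ (range (logBasis k)) ↔ ∃ u, logEmbedding k (Additive.ofMul u) = z := by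
  rw [logBasis, Basis.ofZLatticeBasis_span]
  constructor
  · rintro ⟨u, -, hu⟩
    exact ⟨Additive.toMul u, hu⟩
  · rintro ⟨u, hu⟩
    exact ⟨Additive.ofMul u, trivial, hu⟩

variable (k) in
/-- A measurable set of representatives of the Arakelov divisor classes. -/
def divisorReps : Set (ArakelovDivisor k) :=
  finReps k ×ˢ (logProj k ⁻¹' ZSpan.fundamentalDomain (logBasis k))

theorem measurable_logProj : Measurable (logProj k) :=
  (LinearMap.continuous_of_finiteDimensional _).measurable

theorem measurableSet_divisorReps : MeasurableSet (divisorReps k) :=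
  MeasurableSet.prod (show MeasurableSet[⊤] (finReps k) from trivial)
    (measurable_logProj (ZSpan.fundamentalDomain_measurableSet (logBasis k)))

theorem divisorClass_add_principal (D : ArakelovDivisor k) (f : Additive kˣ) :
    divisorClass k (D + principal k f) = divisorClass k D := by
  have h : divisorClass k (principal k f) = 0 := (QuotientAddGroup.eq_zero_iff _).mpr ⟨f, rfl⟩
  rw [map_add, h, add_zero]

/-- Choosing the representative of the finite part determines the function up to a unit, and the
fundamental domain of the unit lattice determines the unit up to a root of unity. -/
theorem bijOn_divisorReps : BijOn (divisorClass k) (divisorReps k) univ := by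
  refine ⟨mapsTo_univ _ _, ?_, ?_⟩
  · intro D hD E hE hDE
    obtain ⟨f, hf⟩ := QuotientAddGroup.eq.mp hDE
    have hE' : E = D + principal k f := by rw [hf, add_neg_cancel_left]
    have h0 : (principal k f).1 = 0 := by
      refine principal_fst_eq_zero_of_mem_finReps hD.1 ?_
      rw [← Prod.fst_add, ← hE']
      exact hE.1
    obtain ⟨u, rfl⟩ := exists_unit_of_principal_fst_eq_zero h0
    have h1 : logProj k E.2 = -logEmbedding k (Additive.ofMul u) + logProj k D.2 := by
      rw [hE', Prod.snd_add, map_add, logProj_principal_unitToField, add_comm]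
    obtain ⟨_, -, huniq⟩ := ZSpan.exist_unique_vadd_mem_fundamentalDomain (logBasis k)
      (logProj k D.2)
    have hmem : -logEmbedding k (Additive.ofMul u) ∈ Submodule.span ℤ (range (logBasis k)) :=
      neg_mem (mem_span_logBasis.mpr ⟨u, rfl⟩)
    have e1 := huniq ⟨_, hmem⟩ (by
      change -logEmbedding k (Additive.ofMul u) + logProj k D.2 ∈ _
      rw [← h1]
      exact hE.2)
    have e2 := huniq 0 (by
      beta_reduce
      rw [zero_vadd]
      exact hD.2)
    have e3 : -logEmbedding k (Additive.ofMul u) = 0 := congrArg Subtype.val (e1.trans e2.symm)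
    -- A unit in the kernel of the logarithmic embedding is a root of unity; its absolute values are
    -- all `1`, so its divisor is zero.
    rw [neg_eq_zero, logEmbedding_eq_zero_iff, mem_torsion] at e3
    rw [hE', left_eq_add]
    refine Prod.ext h0 ?_
    ext v
    change -((v.mult : ℝ) * Real.log (v (u : k))) = 0
    rw [e3 v]
    simp
  · intro C _
    obtain ⟨D, rfl⟩ := QuotientAddGroup.mk'_surjective _ C
    obtain ⟨f, hf⟩ := exists_add_principal_mem_finReps D.1
    obtain ⟨⟨z, hz⟩, hmem, -⟩ := ZSpan.exist_unique_vadd_mem_fundamentalDomain (logBasis k)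
      (logProj k (D + principal k f).2)
    obtain ⟨u, hu⟩ := mem_span_logBasis.mp hz
    refine ⟨D + principal k f + principal k (unitToField k u⁻¹), ⟨?_, ?_⟩, ?_⟩
    · rw [Prod.fst_add, principal_unitToField_fst, add_zero]
      exact hf
    · rw [mem_preimage, Prod.snd_add, map_add, logProj_principal_unitToField, ofMul_inv, map_neg,
        neg_neg, hu, add_comm]
      exact hmem
    · rw [divisorClass_add_principal, divisorClass_add_principal]

theorem degree_apply (D : ArakelovDivisor k) : degree k D =
    ∑ v, D.2 v - Real.log (FractionalIdeal.absNorm (divisorIdeal D) : ℚ) := rfl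

/-- Among the representatives the only unbounded direction is that of the degree: the fundamental
domain is bounded and the finite parts are finite in number. -/
theorem exists_abs_sub_le_of_mem_divisorReps :
    ∃ B : ℝ, ∀ D ∈ divisorReps k, ∀ v, |D.2 v - weight k v * degree k D| ≤ B := by
  obtain ⟨B₁, hB₁⟩ := (isBounded_iff_forall_norm_le).mp
    (ZSpan.fundamentalDomain_isBounded (logBasis k))
  let N : FinDivisor k → ℝ := fun ν =>
    |Real.log (FractionalIdeal.absNorm (divisorIdeal ((ν, 0) : ArakelovDivisor k)) : ℚ)|
  obtain ⟨B₂, hB₂⟩ := (finite_finReps.image N).bddAbove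
  have hw : ∀ v, 0 ≤ weight k v := fun v => by unfold weight; positivity
  have hw1 : ∀ v, weight k v ≤ 1 := fun v => by
    rw [← sum_weight (k := k)]
    exact Finset.single_le_sum (fun i _ => hw i) (Finset.mem_univ v)
  have hsub : ∀ D ∈ divisorReps k, ∀ v, |D.2 v - weight k v * ∑ i, D.2 i| ≤
      (Fintype.card (InfinitePlace k) + 1) * |B₁| := by
    intro D hD v
    have hp : ∀ w : {w : InfinitePlace k // w ≠ w₀},
        |D.2 w - weight k w * ∑ i, D.2 i| ≤ |B₁| := fun w =>
      ((norm_le_pi_norm (logProj k D.2) w).trans (hB₁ _ hD.2)).trans (le_abs_self _)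
    have hc : (1 : ℝ) * |B₁| ≤ (Fintype.card (InfinitePlace k) + 1) * |B₁| := by
      gcongr
      simp
    -- The coordinate at `w₀` is not seen by `logProj`; it is recovered from the others because they
    -- all sum to zero.
    by_cases hv : v = w₀
    · have h0 : ∑ v, (D.2 v - weight k v * ∑ i, D.2 i) = 0 := by
        rw [Finset.sum_sub_distrib, ← Finset.sum_mul, sum_weight, one_mul, sub_self]
      rw [Fintype.sum_eq_add_sum_subtype_ne _ w₀, ← hv] at h0
      rw [eq_neg_of_add_eq_zero_left h0, abs_neg]
      subst hv
      refine (Finset.abs_sum_le_sum_abs _ _).trans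
        ((Finset.sum_le_sum fun w _ => hp w).trans ?_)
      rw [Finset.sum_const, nsmul_eq_mul]
      gcongr
      refine le_trans ?_ (le_add_of_nonneg_right zero_le_one)
      exact_mod_cast Fintype.card_subtype_le _
    · linarith [hp ⟨v, hv⟩]
  refine ⟨(Fintype.card (InfinitePlace k) + 1) * |B₁| + B₂, fun D hD v => ?_⟩
  have hN : |Real.log (FractionalIdeal.absNorm (divisorIdeal D) : ℚ)| ≤ B₂ :=
    hB₂ ⟨D.1, hD.1, rfl⟩
  have e : D.2 v - weight k v * degree k D = (D.2 v - weight k v * ∑ i, D.2 i) +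
      weight k v * Real.log (FractionalIdeal.absNorm (divisorIdeal D) : ℚ) := by
    rw [degree_apply]
    ring
  rw [e]
  refine (abs_add_le _ _).trans (add_le_add (hsub D hD v) ?_)
  rw [abs_mul, abs_of_nonneg (hw v)]
  exact (mul_le_of_le_one_left (abs_nonneg _) (hw1 v)).trans hN

end

end ArakelovZeta

namespace ArakelovZeta

open MeasureTheory Set Filter Topology NumberField NumberField.InfinitePlace Module
open NumberField.Units NumberField.Units.dirichletUnitTheorem

/-! ### The distribution of the degree -/

section

variable {k : Type*} [Field k] [NumberField k]

instance discreteMeasurableSpace_finDivisor : DiscreteMeasurableSpace (FinDivisor k) :=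
  ⟨fun _ => trivial⟩

variable (k) in
theorem countable_numberField : Countable k := by
  have h : Countable (𝓞 k) := (Module.finBasis ℤ (𝓞 k)).equivFun.toEquiv.injective.countable
  refine Function.Surjective.countable
    (f := fun x : 𝓞 k × 𝓞 k => (x.1 : k) / (x.2 : k)) fun z => ?_
  obtain ⟨a, b, -, h⟩ := IsFractionRing.div_surjective (A := 𝓞 k) z
  exact ⟨(a, b), h⟩

theorem measurable_degree : Measurable (degree k) := by
  refine measurable_from_prod_countable_right fun ν => ?_
  change Measurable fun x : InfinitePlace k → ℝ => ∑ v, x v -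
    Real.log (FractionalIdeal.absNorm (divisorIdeal ((ν, 0) : ArakelovDivisor k)) : ℚ)
  fun_prop

theorem measurable_theta : Measurable (theta : ArakelovDivisor k → ℝ) := by
  have := countable_numberField k
  refine measurable_from_prod_countable_right fun ν => ?_
  change Measurable fun x : InfinitePlace k → ℝ =>
    ∑' f : divisorIdeal ((ν, 0) : ArakelovDivisor k),
      Real.exp (-(Real.pi * divisorNormSq ((ν, x) : ArakelovDivisor k) (f : k)))
  refine Measurable.tsum fun f => ?_
  unfold divisorNormSq
  refine (Real.measurable_exp.comp ((Finset.measurable_sum _ fun v _ => ?_).const_mul _).neg)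
  split_ifs <;> fun_prop

theorem k0_divisorClass (D : ArakelovDivisor k) : k0 (divisorClass k D) = theta D := rfl

theorem k1_divisorClass (D : ArakelovDivisor k) :
    k1 (divisorClass k D) = theta (canonicalDivisor k - D) := by
  rw [k1, ← map_sub, k0_divisorClass]

theorem measurable_k0 : Measurable (k0 : ChowGroup k → ℝ) :=
  measurable_from_quotient.mpr measurable_theta

theorem measurable_k1 : Measurable (k1 : ChowGroup k → ℝ) := by
  refine measurable_from_quotient.mpr ?_
  have e : (k1 ∘ Quotient.mk'' : ArakelovDivisor k → ℝ) =
      fun D => theta (canonicalDivisor k - D) := funext k1_divisorClass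
  rw [e]
  refine measurable_theta.comp (Measurable.prodMk ?_ ?_)
  · exact (measurable_of_countable fun ν : FinDivisor k => (canonicalDivisor k).1 - ν).comp
      measurable_fst
  · exact measurable_snd.const_sub _

variable (k) in
/-- The degree of a class, normalized such that the canonical involution changes its sign. -/
def chowDegree (C : ChowGroup k) : ℝ :=
  QuotientAddGroup.lift (principal k).range (degree k)
    (by rintro _ ⟨f, rfl⟩; exact degree_principal f) C - Real.log (discr k).natAbs / 2

theorem chowDegree_divisorClass (D : ArakelovDivisor k) :
    chowDegree k (divisorClass k D) = degree k D - Real.log (discr k).natAbs / 2 := rfl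

theorem measurable_chowDegree : Measurable (chowDegree k) :=
  measurable_from_quotient.mpr (measurable_degree.sub_const _)

theorem k0_eq_k1_mul_exp (C : ChowGroup k) : k0 C = k1 C * Real.exp (chowDegree k C) := by
  obtain ⟨D, rfl⟩ := QuotientAddGroup.mk'_surjective _ C
  exact (theta_eq_theta_canonicalDivisor_sub D).trans (by rw [k1_divisorClass]; rfl)

theorem one_le_k0 (C : ChowGroup k) : 1 ≤ k0 C := by
  obtain ⟨D, rfl⟩ := QuotientAddGroup.mk'_surjective _ C
  exact one_le_theta D

/-- The degree of `κ` is `log d_k`, twice the shift built into `chowDegree`. -/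
theorem chowDegree_canonicalDivisor_sub (C : ChowGroup k) :
    chowDegree k (divisorClass k (canonicalDivisor k) - C) = -chowDegree k C := by
  obtain ⟨D, rfl⟩ := QuotientAddGroup.mk'_surjective _ C
  rw [← map_sub, chowDegree_divisorClass, chowDegree_divisorClass, map_sub,
    degree_canonicalDivisor]
  ring

theorem measurePreserving_add_prodMk_zero (x : InfinitePlace k → ℝ) :
    MeasurePreserving (fun D : ArakelovDivisor k => D + (0, x)) (divisorMeasure k)
      (divisorMeasure k) := by
  have e : (fun D : ArakelovDivisor k => D + (0, x)) = Prod.map id fun y => y + x := by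
    ext1 D
    simp [Prod.ext_iff]
  rw [e]
  exact (MeasurePreserving.id _).prod (measurePreserving_add_right volume x)

theorem degree_add_smul_weight (D : ArakelovDivisor k) (t : ℝ) :
    degree k (D + (0, t • weight k)) = t + degree k D := by
  have h : degree k ((0, t • weight k) : ArakelovDivisor k) = t := by
    rw [degree_apply]
    have e : divisorIdeal ((0, t • weight k) : ArakelovDivisor k) = 1 := divisorIdeal_zero
    rw [e, FractionalIdeal.absNorm_one]
    simp [← Finset.mul_sum, sum_weight]
  rw [map_add, h, add_comm]

/-- Translation by `t • weight` preserves the measure and the set of representatives and adds `t` to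
the degree, so the image measure is translation invariant. It is finite on compact sets because
representatives of bounded degree are bounded. Uniqueness of Haar measure concludes; the value of
`V` is never needed. -/
theorem exists_map_chowDegree_eq_smul :
    ∃ V : NNReal, (chowMeasure k).map (chowDegree k) = V • (volume : Measure ℝ) := by
  set c : ℝ := Real.log (discr k).natAbs / 2 with hc
  set g : ArakelovDivisor k → ℝ := fun D => degree k D - c with hg
  have hgm : Measurable g := measurable_degree.sub_const _
  have hmap : (chowMeasure k).map (chowDegree k) =
      ((divisorMeasure k).restrict (divisorReps k)).map g := by
    rw [chowMeasure_eq_map measurableSet_divisorReps bijOn_divisorReps,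
      Measure.map_map measurable_chowDegree
        (show Measurable (divisorClass k) from measurable_quotient_mk'')]
    rfl
  rw [hmap]
  set m := ((divisorMeasure k).restrict (divisorReps k)).map g with hm
  have hinv : m.IsAddLeftInvariant := by
    refine ⟨fun t => ?_⟩
    have hT := measurePreserving_add_prodMk_zero (t • weight k)
    have hF : (fun D : ArakelovDivisor k => D + (0, t • weight k)) ⁻¹' divisorReps k =
        divisorReps k := by
      ext D
      simp only [divisorReps, mem_preimage, mem_prod, Prod.fst_add, Prod.snd_add, map_add, map_smul,
        logProj_weight, smul_zero, add_zero]
    have hT' := hT.restrict_preimage measurableSet_divisorReps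
    rw [hF] at hT'
    have hcomm : (fun y => t + y) ∘ g = g ∘ fun D => D + (0, t • weight k) := by
      ext D
      simp only [hg, Function.comp_apply, degree_add_smul_weight]
      ring
    rw [hm, Measure.map_map (measurable_const_add t) hgm, hcomm,
      ← Measure.map_map hgm hT.measurable, hT'.map_eq]
  have hfin : IsFiniteMeasureOnCompacts m := by
    refine ⟨fun K hK => ?_⟩
    obtain ⟨R, hR⟩ := isBounded_iff_forall_norm_le.mp hK.isBounded
    obtain ⟨B, hB⟩ := exists_abs_sub_le_of_mem_divisorReps (k := k)
    rw [hm, Measure.map_apply hgm hK.measurableSet,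
      Measure.restrict_apply (hgm hK.measurableSet)]
    set R' : ℝ := |R| + |c| + |B| with hR'
    refine lt_of_le_of_lt (measure_mono (t := finReps k ×ˢ Metric.closedBall 0 R') ?_) ?_
    · rintro D ⟨hDK, hD⟩
      refine ⟨hD.1, ?_⟩
      rw [mem_closedBall_zero_iff, pi_norm_le_iff_of_nonneg (by positivity)]
      intro v
      have h1 := hB D hD v
      have h2 := hR _ hDK
      simp only [hg, Real.norm_eq_abs] at h2
      have hw : 0 ≤ weight k v := by unfold weight; positivity
      have hw1 : weight k v ≤ 1 := by
        rw [← sum_weight (k := k)]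
        exact Finset.single_le_sum (f := weight k)
          (fun i _ => by unfold weight; positivity) (Finset.mem_univ v)
      have h3 : |degree k D| ≤ |R| + |c| := by
        have := abs_sub_abs_le_abs_sub (degree k D) c
        linarith [le_abs_self R]
      have h4 : |weight k v * degree k D| ≤ |R| + |c| := by
        rw [abs_mul, abs_of_nonneg hw]
        exact (mul_le_of_le_one_left (abs_nonneg _) hw1).trans h3
      have h5 := abs_sub_abs_le_abs_sub (D.2 v) (weight k v * degree k D)
      rw [Real.norm_eq_abs]
      linarith [le_abs_self B]
    · rw [divisorMeasure, Measure.prod_prod]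
      refine ENNReal.mul_lt_top ?_ measure_closedBall_lt_top
      exact (Measure.count_apply_lt_top).mpr finite_finReps
  exact ⟨_, Measure.isAddLeftInvariant_eq_smul m volume⟩

end

/-! ### Decay of the theta series -/

section

variable {k : Type*} [Field k] [NumberField k]

open NumberField.mixedEmbedding

open scoped Classical

/-- A nonzero element has a nonzero integer coordinate, so its coordinate vector has squared length
at least `1`. -/
theorem exists_le_divisorNormSq (D : ArakelovDivisor k) :
    ∃ m : ℝ, 0 < m ∧ ∀ f ∈ divisorIdeal D, f ≠ 0 → m ≤ divisorNormSq D f := by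
  obtain ⟨c, hc, h⟩ := exists_mul_sum_sq_le_mixedNormSq D.2
    (fractionalIdealLatticeBasis k (divisorIdealUnit D))
  refine ⟨c, hc, fun f hf hf0 => ?_⟩
  have hB := fractionalIdealLatticeBasis_apply k (divisorIdealUnit D)
  have hb := mem_span_basisOfFractionalIdeal_divisorIdealUnit D
  obtain ⟨m, hm⟩ := (latticeEquiv _ hb).surjective ⟨f, hf⟩
  have e : ∑ i, m i • basisOfFractionalIdeal k (divisorIdealUnit D) i = f := by
    rw [← coe_latticeEquiv _ hb, hm]
  have hm0 : m ≠ 0 := by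
    rintro rfl
    apply hf0
    rw [← e]
    simp
  obtain ⟨i, hi⟩ := Function.ne_iff.mp hm0
  have h1 : (1 : ℝ) ≤ ∑ i, ((m i : ℤ) : ℝ) ^ 2 := by
    have h2 : (1 : ℝ) ≤ ((m i : ℤ) : ℝ) ^ 2 := by
      rw [one_le_sq_iff_one_le_abs]
      exact_mod_cast Int.one_le_abs hi
    exact h2.trans (Finset.single_le_sum (f := fun i => ((m i : ℤ) : ℝ) ^ 2)
      (fun j _ => sq_nonneg _) (Finset.mem_univ i))
  rw [divisorNormSq_eq_mixedNormSq, ← e, mixedEmbedding_sum_smul hB]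
  refine le_trans ?_ (h fun i => (m i : ℝ))
  nlinarith

/-- The factor `mult v` compensates for the exponents `-2 x` at real and `-x` at complex places:
every term scales by the same `exp (-(2 r))`. -/
theorem exp_mul_divisorNormSq_le {D : ArakelovDivisor k} {ν : FinDivisor k} {r : ℝ}
    (h : ∀ v, D.2 v ≤ mult v * r) (f : k) :
    Real.exp (-(2 * r)) * divisorNormSq ((ν, 0) : ArakelovDivisor k) f ≤ divisorNormSq D f := by
  rw [divisorNormSq, divisorNormSq, Finset.mul_sum]
  refine Finset.sum_le_sum fun v _ => ?_
  have hv := h v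
  split_ifs with hr
  · rw [mult, if_pos hr] at hv
    have : Real.exp (-(2 * r)) ≤ Real.exp (-2 * D.2 v) := by
      apply Real.exp_le_exp.mpr
      push_cast at hv
      linarith
    simp only [Pi.zero_apply, mul_zero, Real.exp_zero, mul_one]
    nlinarith [sq_nonneg (v f)]
  · rw [mult, if_neg hr] at hv
    have : Real.exp (-(2 * r)) ≤ Real.exp (-D.2 v) := by
      apply Real.exp_le_exp.mpr
      push_cast at hv
      linarith
    simp only [Pi.zero_apply, neg_zero, Real.exp_zero, mul_one]
    nlinarith [sq_nonneg (v f)]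

theorem divisorNormSq_mult_mul (ν : FinDivisor k) (r : ℝ) (f : k) :
    divisorNormSq ((ν, fun v => mult v * r) : ArakelovDivisor k) f =
      Real.exp (-(2 * r)) * divisorNormSq ((ν, 0) : ArakelovDivisor k) f := by
  rw [divisorNormSq, divisorNormSq, Finset.mul_sum]
  refine Finset.sum_congr rfl fun v _ => ?_
  split_ifs with hr
  · simp only [mult, if_pos hr, Pi.zero_apply, mul_zero, Real.exp_zero]
    push_cast
    ring_nf
  · simp only [mult, if_neg hr, Pi.zero_apply, neg_zero, Real.exp_zero]
    push_cast
    ring_nf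

/-- If all coefficients of `D` are small, the theta series is close to its constant term. -/
theorem exists_theta_le (ν : FinDivisor k) (b : ℝ) :
    ∃ C c : ℝ, 0 ≤ C ∧ 0 < c ∧ ∀ (x : InfinitePlace k → ℝ) (t : ℝ), 0 ≤ t →
      (∀ v, x v ≤ mult v * (b - t)) →
        theta ((ν, x) : ArakelovDivisor k) ≤ 1 + C * Real.exp (-(c * Real.exp (2 * t))) := by
  set Q : k → ℝ := divisorNormSq ((ν, 0) : ArakelovDivisor k) with hQ
  obtain ⟨m, hm, hmQ⟩ := exists_le_divisorNormSq ((ν, 0) : ArakelovDivisor k)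
  set a : ℝ := Real.exp (-(2 * b)) with ha
  have ha0 : 0 < a := Real.exp_pos _
  -- With this shift the series `∑ exp (-π (a/2) Q f)` is itself a theta series, hence summable.
  -- Half of the exponent `a E Q f` is spent on this convergence, and the other half, where `Q f ≥
  -- m`, gives the decay in `E`.
  set b' : ℝ := -(Real.log (a / 2) / 2) with hb'
  have hb'a : Real.exp (-(2 * b')) = a / 2 := by
    rw [hb', show -(2 * -(Real.log (a / 2) / 2)) = Real.log (a / 2) by ring,
      Real.exp_log (by positivity)]
  have hsum := summable_theta ((ν, fun v => mult v * b') : ArakelovDivisor k)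
  simp only [divisorNormSq_mult_mul, hb'a] at hsum
  change Summable fun f : divisorIdeal ((ν, 0) : ArakelovDivisor k) =>
    Real.exp (-(Real.pi * (a / 2 * Q f))) at hsum
  set I := divisorIdeal ((ν, 0) : ArakelovDivisor k) with hI
  refine ⟨∑' f : I, Real.exp (-(Real.pi * (a / 2 * Q f))), Real.pi * (a / 2 * m),
    tsum_nonneg fun _ => (Real.exp_pos _).le, by positivity, fun x t ht hx => ?_⟩
  set E : ℝ := Real.exp (2 * t) with hE
  have hE1 : 1 ≤ E := Real.one_le_exp (by linarith)
  have hle : ∀ f : k, a * E * Q f ≤ divisorNormSq ((ν, x) : ArakelovDivisor k) f := fun f => by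
    have := exp_mul_divisorNormSq_le (D := (ν, x)) (ν := ν) hx f
    rwa [show -(2 * (b - t)) = -(2 * b) + 2 * t by ring, Real.exp_add] at this
  have hs : Summable fun f : I =>
      Real.exp (-(Real.pi * divisorNormSq ((ν, x) : ArakelovDivisor k) (f : k))) :=
    summable_theta ((ν, x) : ArakelovDivisor k)
  have hQ0 : ∀ f, 0 ≤ Q f := fun f => divisorNormSq_nonneg _ f
  change ∑' f : I, Real.exp (-(Real.pi * divisorNormSq ((ν, x) : ArakelovDivisor k) (f : k))) ≤ _
  rw [hs.tsum_eq_add_tsum_ite ⟨0, I.zero_mem⟩, ← tsum_mul_right]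
  refine add_le_add ?_ (Summable.tsum_le_tsum (fun f => ?_) ?_ (hsum.mul_right _))
  · rw [Real.exp_le_one_iff]
    exact neg_nonpos.mpr (mul_nonneg Real.pi_pos.le (divisorNormSq_nonneg _ _))
  · split_ifs with hf
    · positivity
    · rw [← Real.exp_add, Real.exp_le_exp]
      have h1 : m ≤ Q f := hmQ f f.2 fun h => hf (Subtype.ext h)
      have h2 := hle f
      have h3 : a / 2 * m * E + a / 2 * Q f ≤ a * E * Q f := by
        have e1 : a / 2 * m * E ≤ a / 2 * Q f * E := by gcongr
        have e2 : a / 2 * Q f * 1 ≤ a / 2 * Q f * E := by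
          have := hQ0 f
          gcongr
        linarith
      have h4 := mul_le_mul_of_nonneg_left (h3.trans h2) Real.pi_pos.le
      linarith
  · refine Summable.of_nonneg_of_le (fun f => ?_) (fun f => ?_) hs
    · split_ifs
      · exact le_rfl
      · positivity
    · split_ifs
      · positivity
      · exact le_rfl

/-- On a representative, `x_v` is within a bounded distance of `weight v * deg`, hence at most `mult
v * (const - |y| / n)` for `y ≤ 0` with `n = [k : ℚ]`. `exists_theta_le` then applies with `t = |y|
/ n`, giving `κ = 2 / n`; finitely many finite parts make the constants uniform. -/
theorem exists_k0_le : ∃ C c κ : ℝ, 0 ≤ C ∧ 0 < c ∧ 0 < κ ∧ ∀ x : ChowGroup k,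
    chowDegree k x ≤ 0 → k0 x ≤ 1 + C * Real.exp (-(c * Real.exp (κ * |chowDegree k x|))) := by
  obtain ⟨B, hB⟩ := exists_abs_sub_le_of_mem_divisorReps (k := k)
  set c₀ : ℝ := Real.log (discr k).natAbs / 2 with hc₀
  set n : ℝ := (finrank ℚ k : ℝ) with hn
  have hn0 : 0 < n := Nat.cast_pos.mpr (finrank_pos (R := ℚ) (M := k))
  choose C c hC hc h using fun ν : FinDivisor k => exists_theta_le ν (|B| + c₀ / n)
  obtain ⟨C', hC'⟩ := ((finite_finReps (k := k)).image C).bddAbove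
  -- An upper bound for the inverses gives a positive lower bound for the `c ν`.
  obtain ⟨M, hM⟩ := ((finite_finReps (k := k)).image fun ν => (c ν)⁻¹).bddAbove
  have hc' : ∀ ν ∈ finReps k, (|M| + 1)⁻¹ ≤ c ν := fun ν hν =>
    inv_le_of_inv_le₀ (hc ν) (by linarith [hM ⟨ν, hν, rfl⟩, le_abs_self M])
  refine ⟨|C'|, (|M| + 1)⁻¹, 2 * (1 / n), abs_nonneg _, by positivity, by positivity, fun x hx => ?_⟩
  obtain ⟨D, hD, rfl⟩ := bijOn_divisorReps.surjOn (mem_univ x)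
  rw [k0_divisorClass]
  set y := chowDegree k (divisorClass k D) with hy
  have hyD : degree k D = y + c₀ := by
    rw [hy, chowDegree_divisorClass, sub_add_cancel]
  rw [mul_assoc]
  refine (h D.1 D.2 (1 / n * |y|) (by positivity) fun v => ?_).trans ?_
  · have h1 := (abs_le.mp (hB D hD v)).2
    rw [hyD] at h1
    have hm : (1 : ℝ) ≤ mult v := by exact_mod_cast one_le_mult
    have e : mult v * (|B| + c₀ / n - 1 / n * |y|) = mult v * |B| + weight k v * (y + c₀) := by
      rw [abs_of_nonpos hx, weight]
      ring
    rw [e]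
    have := mul_le_mul_of_nonneg_right hm (abs_nonneg B)
    linarith [le_abs_self B]
  · have h1 : C D.1 ≤ |C'| := (hC' ⟨D.1, hD.1, rfl⟩).trans (le_abs_self _)
    have h2 := hc' D.1 hD.1
    gcongr

end

end ArakelovZeta

namespace ArakelovZeta

open MeasureTheory Set Filter Topology NumberField

/-! ### The two-variable `L`-function -/

/-- On the complex line joining `(-1, -2)`, an interior point of the region where the formula is
prescribed, to `(s, w)`, the one-variable identity theorem applies. -/
theorem IsTwoVariableL.unique {k : Type*} [Field k] [NumberField k] {L₁ L₂ : ℂ → ℂ → ℂ}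
    (h₁ : IsTwoVariableL k L₁) (h₂ : IsTwoVariableL k L₂) : L₁ = L₂ := by
  funext s w
  let γ : ℂ → ℂ × ℂ := fun t => (-1 + t * (s + 1), -2 + t * (w + 2))
  have hγ : Differentiable ℂ γ := by fun_prop
  have e : ∀ᶠ t in 𝓝 (0 : ℂ), L₁ (γ t).1 (γ t).2 = L₂ (γ t).1 (γ t).2 := by
    have hc1 : Continuous fun t : ℂ => (γ t).1.re := by fun_prop
    have hc2 : Continuous fun t : ℂ => (γ t).2.re := by fun_prop
    have o1 : ∀ᶠ t in 𝓝 (0 : ℂ), (γ t).2.re < (γ t).1.re :=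
      (isOpen_lt hc2 hc1).mem_nhds (by simp [γ])
    have o2 : ∀ᶠ t in 𝓝 (0 : ℂ), (γ t).1.re < 0 :=
      (isOpen_lt hc1 continuous_const).mem_nhds (by simp [γ])
    filter_upwards [o1, o2] with t h h'
    rw [h₁.2 _ _ h h', h₂.2 _ _ h h']
  have a1 : Differentiable ℂ fun t => L₁ (γ t).1 (γ t).2 := h₁.1.comp hγ
  have a2 : Differentiable ℂ fun t => L₂ (γ t).1 (γ t).2 := h₂.1.comp hγ
  have := AnalyticOnNhd.eq_of_eventuallyEq (z₀ := 0)
    (Complex.analyticOnNhd_univ_iff_differentiable.mpr a1)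
    (Complex.analyticOnNhd_univ_iff_differentiable.mpr a2) e
  simpa [γ] using congrFun this 1

/-- A function of `s` built from factors of order at most one has order at most one. -/
theorem growthOrder_le_one {f : ℂ → ℂ} (w : ℂ) {A D V : ℝ} (hA : 0 ≤ A) (hD : 0 ≤ D) (hV : 0 ≤ V)
    (hf : ∀ ε : ℝ, 0 < ε → ∃ C, 0 ≤ C ∧ ∀ s, ‖f s‖ ≤ A * Real.exp (D * ‖s‖) *
      (V + ‖s‖ * ‖s - w‖ * (C * Real.exp (‖s - w‖ ^ (1 + ε)) + C * Real.exp (‖s‖ ^ (1 + ε))))) :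
    growthOrder f ≤ 1 := by
  refine ENNReal.le_of_forall_pos_le_add fun ε hε _ => ?_
  have hε' : (0 : ℝ) < ε := by exact_mod_cast hε
  refine (iInf₂_le (1 + ε) ?_).trans (by simp)
  -- The hypothesis is used with `ε / 2`. The spare factor `‖s‖ ^ (ε / 2)` tends to infinity and
  -- absorbs the shift by `w`, the exponent `D ‖s‖` and the polynomial factor, which is at most `2
  -- exp (2 ‖s‖)`.
  set b : ℝ := 1 + (ε : ℝ) / 2 with hb
  have hb0 : 0 < b := by positivity
  obtain ⟨C, hC0, hC⟩ := hf (ε / 2) (by positivity)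
  have hinf : Tendsto (fun s : ℂ => ‖s‖) (Bornology.cobounded ℂ) atTop := tendsto_norm_cobounded_atTop
  have ht : Tendsto (fun s : ℂ => ‖s‖ ^ ((ε : ℝ) / 2)) (Bornology.cobounded ℂ) atTop :=
    (tendsto_rpow_atTop (by positivity)).comp hinf
  refine Asymptotics.IsBigO.of_bound (A * (V + 4 * C)) ?_
  filter_upwards [hinf.eventually_ge_atTop (‖w‖ + 1), ht.eventually_ge_atTop (D + 2 + 2 ^ b)]
    with s h1 h2
  have hw := norm_nonneg w
  have hs1 : 1 ≤ ‖s‖ := by linarith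
  have hs0 : 0 ≤ ‖s‖ := by linarith
  have hsw : ‖s - w‖ ≤ 2 * ‖s‖ := by
    have := norm_sub_le s w
    linarith
  have hsb : ‖s‖ ≤ ‖s‖ ^ b := by
    conv_lhs => rw [← Real.rpow_one ‖s‖]
    exact Real.rpow_le_rpow_of_exponent_le hs1 (by rw [hb]; linarith)
  have e1 : ‖s - w‖ ^ b ≤ 2 ^ b * ‖s‖ ^ b := by
    rw [← Real.mul_rpow two_pos.le hs0]
    exact Real.rpow_le_rpow (norm_nonneg _) hsw hb0.le
  have e2 : ‖s‖ ^ b ≤ 2 ^ b * ‖s‖ ^ b :=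
    le_mul_of_one_le_left (by positivity) (Real.one_le_rpow one_le_two hb0.le)
  have e3 : ‖s‖ ^ ((1 + ε : NNReal) : ℝ) = ‖s‖ ^ b * ‖s‖ ^ ((ε : ℝ) / 2) := by
    rw [← Real.rpow_add (by linarith), hb]
    push_cast
    ring_nf
  have e4 : (D + 2) * ‖s‖ + 2 ^ b * ‖s‖ ^ b ≤ ‖s‖ ^ ((1 + ε : NNReal) : ℝ) := by
    rw [e3]
    calc (D + 2) * ‖s‖ + 2 ^ b * ‖s‖ ^ b ≤ (D + 2) * ‖s‖ ^ b + 2 ^ b * ‖s‖ ^ b := by gcongr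
      _ = ‖s‖ ^ b * (D + 2 + 2 ^ b) := by ring
      _ ≤ _ := by gcongr
  have e5 : ‖s‖ * ‖s - w‖ ≤ 2 * Real.exp (2 * ‖s‖) := by
    have h := Real.add_one_le_exp ‖s‖
    have : ‖s‖ ≤ Real.exp ‖s‖ := by linarith
    calc ‖s‖ * ‖s - w‖ ≤ ‖s‖ * (2 * ‖s‖) := by gcongr
      _ = 2 * (‖s‖ * ‖s‖) := by ring
      _ ≤ 2 * (Real.exp ‖s‖ * Real.exp ‖s‖) := by gcongr
      _ = _ := by rw [← Real.exp_add]; ring_nf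
  rw [Real.norm_of_nonneg (Real.exp_pos _).le]
  have h3 := Real.exp_le_exp.mpr e1
  have h4 := Real.exp_le_exp.mpr e2
  have h5 : (1 : ℝ) ≤ Real.exp (2 * ‖s‖) * Real.exp (2 ^ b * ‖s‖ ^ b) :=
    one_le_mul_of_one_le_of_one_le (Real.one_le_exp (by positivity))
      (Real.one_le_exp (by positivity))
  calc ‖f s‖ ≤ _ := hC s
    _ ≤ A * Real.exp (D * ‖s‖) * (V * (Real.exp (2 * ‖s‖) * Real.exp (2 ^ b * ‖s‖ ^ b)) +
        2 * Real.exp (2 * ‖s‖) * (C * Real.exp (2 ^ b * ‖s‖ ^ b) +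
          C * Real.exp (2 ^ b * ‖s‖ ^ b))) := by
        gcongr
        exact le_mul_of_one_le_right hV h5
    _ = A * (V + 4 * C) * Real.exp ((D + 2) * ‖s‖ + 2 ^ b * ‖s‖ ^ b) := by
        rw [Real.exp_add, add_mul, Real.exp_add]
        ring
    _ ≤ _ := by gcongr

section Continuation

variable {k : Type*} [Field k] [NumberField k]

/-- The analytic consequences of the Riemann-Roch theorem, of the finiteness of the volume of the
degree-zero part, and of the decay of `k⁰ - 1`. -/
theorem twoVariableL_of_estimates {y : ChowGroup k → ℝ} {V : NNReal} (hy : Measurable y)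
    (hV : (chowMeasure k).map y = V • (volume : Measure ℝ))
    (hα : Measurable (k0 : ChowGroup k → ℝ)) (hβ : Measurable (k1 : ChowGroup k → ℝ))
    (hα1 : ∀ x : ChowGroup k, 1 ≤ k0 x) (hβ1 : ∀ x : ChowGroup k, 1 ≤ k1 x)
    (hαβ : ∀ x : ChowGroup k, k0 x = k1 x * Real.exp (y x))
    {C c κ : ℝ} (hC : 0 ≤ C) (hc : 0 < c) (hκ : 0 < κ)
    (hα' : ∀ x, y x ≤ 0 → k0 x ≤ 1 + C * Real.exp (-(c * Real.exp (κ * |y x|))))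
    (hβ' : ∀ x, 0 < y x → k1 x ≤ 1 + C * Real.exp (-(c * Real.exp (κ * |y x|)))) :
    (∀ s t : ℂ, s.re < 0 → t.re < 0 → Integrable (zetaIntegrand k s t) (chowMeasure k)) ∧
    (∃! L : ℂ → ℂ → ℂ, IsTwoVariableL k L) ∧
    ∀ L : ℂ → ℂ → ℂ, IsTwoVariableL k L → ∀ w : ℂ, growthOrder (fun s => L s w) ≤ 1 := by
  have hd : ((discr k).natAbs : ℂ) ≠ 0 := by
    exact_mod_cast Int.natAbs_ne_zero.mpr (discr_ne_zero k)
  have hd1 : (1 : ℝ) ≤ ((discr k).natAbs : ℝ) := by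
    exact_mod_cast Nat.one_le_iff_ne_zero.mpr (Int.natAbs_ne_zero.mpr (discr_ne_zero k))
  set K : ℂ := (2 : ℂ) ^ ((InfinitePlace.nrRealPlaces k : ℂ) / 2) / (Units.torsionOrder k : ℂ)
    with hK
  set J₁ := expTransform (chowMeasure k) (logLower y k0) y
  set J₂ := expTransform (chowMeasure k) (logUpper y k1) y
  have hB₁ := fun x => le_of_le_mul_exp_neg_exp hC hc (logLower_le hC hα1 hα' x)
  have hB₂ := fun x => le_of_le_mul_exp_neg_exp hC hc (logUpper_le hC hβ1 hβ' x)
  have hm₁ := measurable_logLower hy hα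
  have hm₂ := measurable_logUpper hy hβ
  have hi₁ := fun (p : ℝ) (hp : 0 < p) => integrable_mul_exp_abs_rpow hy hV hm₁
    (logLower_nonneg hα1) hc hκ (logLower_le hC hα1 hα') hp
  have hi₂ := fun (p : ℝ) (hp : 0 < p) => integrable_mul_exp_abs_rpow hy hV hm₂
    (logUpper_nonneg hβ1) hc hκ (logUpper_le hC hβ1 hβ') hp
  -- This is the formula of `integral_cpow_mul_cpow` multiplied by `s (s - w) / w`, which cancels
  -- both the outer factor `w` and the poles on `s = 0` and `s = w`.
  let L : ℂ → ℂ → ℂ := fun s w => (1 / (2 * Real.pi) ^ 2 * K) *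
    ((discr k).natAbs : ℂ) ^ (-s / 2) * (V + s * (s - w) * (J₁ (s - w) w + J₂ s w))
  have hL : IsTwoVariableL k L := by
    constructor
    · have d1 : Differentiable ℂ fun z : ℂ × ℂ => J₁ z.1 z.2 :=
        differentiable_expTransform hm₁ hy (logLower_nonneg hα1) hB₁ (hi₁ 2 two_pos)
      have d2 : Differentiable ℂ fun z : ℂ × ℂ => J₂ z.1 z.2 :=
        differentiable_expTransform hm₂ hy (logUpper_nonneg hβ1) hB₂ (hi₂ 2 two_pos)
      have d3 : Differentiable ℂ fun z : ℂ × ℂ => J₁ (z.1 - z.2) z.2 :=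
        d1.comp (by fun_prop : Differentiable ℂ fun z : ℂ × ℂ => (z.1 - z.2, z.2))
      have d4 : Differentiable ℂ fun z : ℂ × ℂ => ((discr k).natAbs : ℂ) ^ (-z.1 / 2) := by
        intro z
        exact DifferentiableAt.const_cpow (by fun_prop) (Or.inl hd)
      exact (d4.const_mul _).mul
        ((((by fun_prop : Differentiable ℂ fun z : ℂ × ℂ => z.1 * (z.1 - z.2))).mul
          (d3.add d2)).const_add _)
    · intro s w hws hs
      have hs0 : s ≠ 0 := fun h => by simp [h] at hs
      have hw0 : w ≠ 0 := fun h => by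
        rw [h, Complex.zero_re] at hws
        exact absurd hws hs.not_gt
      have hsw0 : s - w ≠ 0 := fun h => by
        rw [sub_eq_zero.mp h] at hws
        exact absurd hws (lt_irrefl _)
      have hZ : zetaX k s w = w * (V / (s * (s - w)) + (J₁ (s - w) w + J₂ s w)) :=
        integral_cpow_mul_cpow hy hV hα hβ hα1 hβ1 hαβ hC hc hκ hα' hβ' hws hs
      have hpi : (Real.pi : ℂ) ≠ 0 := by exact_mod_cast Real.pi_ne_zero
      rw [zetaNormalized, hZ, ← hK]
      simp only [L]
      field_simp
  refine ⟨fun s t hs ht => integrable_cpow_mul_cpow hy hV hα hβ hα1 hβ1 hαβ hs ht,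
    ⟨L, hL, fun L' hL' => hL'.unique hL⟩, fun L' hL' w => ?_⟩
  rw [hL'.unique hL]
  refine growthOrder_le_one w (A := ‖(1 / (2 * Real.pi) ^ 2 * K : ℂ)‖)
    (D := Real.log ((discr k).natAbs : ℝ)) (V := V) (norm_nonneg _) (Real.log_nonneg hd1) V.2
    fun ε hε => ?_
  obtain ⟨C₁, hC₁0, hC₁⟩ := exists_norm_expTransform_le (logLower_nonneg hα1) hB₁ hi₁ w hε
  obtain ⟨C₂, hC₂0, hC₂⟩ := exists_norm_expTransform_le (logUpper_nonneg hβ1) hB₂ hi₂ w hε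
  refine ⟨max C₁ C₂, le_max_of_le_left hC₁0, fun s => ?_⟩
  have hV' : ‖(V : ℂ)‖ = V := (Complex.norm_real _).trans (Real.norm_of_nonneg V.2)
  have hcp : ‖((discr k).natAbs : ℂ) ^ (-s / 2)‖ ≤
      Real.exp (Real.log ((discr k).natAbs : ℝ) * ‖s‖) := by
    have h0 : (0 : ℝ) < ((discr k).natAbs : ℝ) := by linarith
    have h := Complex.norm_cpow_eq_rpow_re_of_pos h0 (-s / 2)
    rw [Complex.ofReal_natCast] at h
    rw [h, Real.rpow_def_of_pos h0]
    refine Real.exp_le_exp.mpr (mul_le_mul_of_nonneg_left ?_ (Real.log_nonneg hd1))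
    have h1 := Complex.abs_re_le_norm (-s / 2)
    have h2 : ‖-s / 2‖ ≤ ‖s‖ := by
      rw [norm_div, norm_neg]
      simp
    exact (le_abs_self _).trans (h1.trans h2)
  have e1 : ‖J₁ (s - w) w‖ ≤ max C₁ C₂ * Real.exp (‖s - w‖ ^ (1 + ε)) :=
    (hC₁ _).trans (mul_le_mul_of_nonneg_right (le_max_left _ _) (Real.exp_pos _).le)
  have e2 : ‖J₂ s w‖ ≤ max C₁ C₂ * Real.exp (‖s‖ ^ (1 + ε)) :=
    (hC₂ _).trans (mul_le_mul_of_nonneg_right (le_max_right _ _) (Real.exp_pos _).le)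
  simp only [L]
  rw [norm_mul, norm_mul]
  refine mul_le_mul (mul_le_mul_of_nonneg_left hcp (norm_nonneg _)) ?_ (norm_nonneg _)
    (by positivity)
  refine (norm_add_le _ _).trans ?_
  rw [hV', norm_mul, norm_mul]
  have e3 := (norm_add_le (J₁ (s - w) w) (J₂ s w)).trans (add_le_add e1 e2)
  gcongr

end Continuation

end ArakelovZeta

end

theorem proposition3p5 (k : Type*) [Field k] [NumberField k] :
    (∀ s t : ℂ, s.re < 0 → t.re < 0 →
      MeasureTheory.Integrable (ArakelovZeta.zetaIntegrand k s t) (ArakelovZeta.chowMeasure k)) ∧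
    (∃! L : ℂ → ℂ → ℂ, ArakelovZeta.IsTwoVariableL k L) ∧
    ∀ L : ℂ → ℂ → ℂ, ArakelovZeta.IsTwoVariableL k L →
      ∀ w : ℂ, ArakelovZeta.growthOrder (fun s => L s w) ≤ 1 := by
  obtain ⟨V, hV⟩ := ArakelovZeta.exists_map_chowDegree_eq_smul (k := k)
  obtain ⟨C, c, κ, hC, hc, hκ, h⟩ := ArakelovZeta.exists_k0_le (k := k)
  refine ArakelovZeta.twoVariableL_of_estimates ArakelovZeta.measurable_chowDegree hV
    ArakelovZeta.measurable_k0 ArakelovZeta.measurable_k1 ArakelovZeta.one_le_k0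
    (fun x => ArakelovZeta.one_le_k0 _) ArakelovZeta.k0_eq_k1_mul_exp hC hc hκ h fun x hx => ?_
  -- The bound for `k1` on `y > 0` is the bound for `k0` at `[κ] - x`, where `y` has the opposite
  -- sign.
  have := h (ArakelovZeta.divisorClass k (ArakelovZeta.canonicalDivisor k) - x)
  rw [ArakelovZeta.chowDegree_canonicalDivisor_sub, abs_neg] at this
  exact this (neg_nonpos.mpr hx.le)
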